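/- For $\tau$ in the upper half-plane let $q=e^{2\pi i\tau}$, let $\eta(\tau)=q^{1/24}\prod_{j\ge 1}(1-q^{j})$ be the Dedekind eta function, and put $$Z(\tau)=\Big(\sum_{m=-\infty}^{\infty}\sum_{n=-\infty}^{\infty}q^{m^2+5n^2}\Big)^2,\qquad z(\tau)=\eta(2\tau)^2\eta(10\tau)^2,\qquad X(\tau)=\frac{z(\tau)}{Z(\tau)}.$$ Let $(a_n)_{n\ge 0}$ be the sequence of rational numbers determined by $a_0=1$, $a_1=4$, $a_2=20$ and $$(n+1)^3a_{n+1}=4(2n+1)(2n^2+2n+1)\,a_n-16n(4n^2+1)\,a_{n-1}+8(2n-1)^3a_{n-2}\qquad(n\ge 2).$$ Then the power series $\sum_{n\ge 0}a_nx^n$ converges for every complex $x$ with $|x|<\frac{3-\sqrt5}{8}$. Moreover, let $\Omega$ be the connected component at the cusp $i\infty$ of the set $\{\tau:\operatorname{Im}\tau>0,\ |X(\tau)|<\frac{3-\sqrt5}{8}\}$, that is, the union of all connected subsets of this set that contain a half-plane $\{\operatorname{Im}\tau>C\}$. Then $\Omega$ contains such a half-plane, and for every $\tau\in\Omega$ $$Z(\tau)=\sum_{n=0}^{\infty}a_n\,X(\tau)^n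 .$$ -/

import Mathlib

namespace Level20

noncomputable section

/-- The nome `q = exp (2 π i τ)`. -/
def nome (τ : ℂ) : ℂ := Complex.exp (2 * Real.pi * Complex.I * τ)

/-- The weight two theta function
`Z = (∑_{m ∈ ℤ} ∑_{n ∈ ℤ} q ^ (m² + 5 n²))²`, where `q = exp (2 π i τ)`. -/
def Z (τ : ℂ) : ℂ := (∑' m : ℤ, ∑' n : ℤ, nome τ ^ (m ^ 2 + 5 * n ^ 2)) ^ 2

/-- The eta product `z = η(2τ)² η(10τ)²`. -/
def z (τ : ℂ) : ℂ := ModularForm.eta (2 * τ) ^ 2 * ModularForm.eta (10 * τ) ^ 2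

/-- The modular function `X = z / Z`. -/
def X (τ : ℂ) : ℂ := z τ / Z τ


/-- The set of all `τ` in the upper half-plane with `|X(τ)| < (3 - √5) / 8`. -/
def smallX : Set ℂ := {τ : ℂ | 0 < τ.im ∧ ‖X τ‖ < (3 - Real.sqrt 5) / 8}

/-- The connected component of `smallX` at the cusp `i∞`: the union of all connected subsets
of `smallX` that contain a half-plane `{Im τ > C}`. -/
def cuspComponent : Set ℂ :=
  ⋃₀ {S : Set ℂ | S ⊆ smallX ∧ IsPreconnected S ∧ ∃ C : ℝ, {τ : ℂ | C < τ.im} ⊆ S}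

end

end Level20

/-!
Write `t = 2 τ` and `q = exp (π i t)`. Then `Z = θ₃(t)² θ₃(5t)²` and `z = η(t)² η(5t)²` have weight two,
and with `D = q d/dq` they satisfy

* `(Z Dz - z DZ)² = z² Z (Z - 4 z) (Z² - 12 z Z + 16 z²)`,
* `2 Z D²Z - 3 (DZ)² = 8 Z z (Z² - 10 Z z + 18 z²)`.

Both identities are proved by a valence argument. The difference of the two sides, divided by `z ^ 6`
or `z ^ 4`, is a function `F₃` of weight zero without poles on the upper half-plane. It belongs to a
triple `F₃, F₄, F₂`, one function for each even theta constant, which is permuted by the translation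
`t + 1`, by the Fricke involution `-1 / (5 t)` and by the elliptic involution `(2 t - 1) / (5 t - 2)`
(`firstForm_secondForm_permuted`). The product `G = F₃ F₄ F₂` is invariant under these maps, hence
`G(t) ∏ G((t + k) / 5)`, with `k` running modulo five, is a modular function of level one
(`eq_zero_of_levelFive_invariant`). The first Taylor coefficients show that `F₃` and `F₄` are
bounded at `i∞` and that `F₂` vanishes there. So the level one function is a cusp form of weight
zero; it vanishes, and with it `F₃`. The result is `series_differential_equations`.

Let `X = z / Z`, `g = DX / X` and `θ = g⁻¹ D`, so that `θ` acts on functions of `X` as `X d/dX`. The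
first identity says `g² = Z² (1 - 4 X) (1 - 12 X + 16 X²)`. With it, the derivative of the second one is
a linear differential equation of order three for `Z` (`third_order_of_second_order`). The
recurrence says that the generating function `∑ aₙ Xⁿ` satisfies the same equation
(`genFun_differential_equation`). All exponents of the equation at `X = 0` are zero, and both solutions
are holomorphic in `q` with value one at `q = 0`; therefore they agree near the cusp
(`eventually_ZSeries_eq_genFun`).

The radius of convergence is read off the roots `4`, `6 ± 2 √5` of the characteristic polynomial of
the recurrence (`growthLE_coeff`). Finally the identity extends to every connected subset of
`smallX` that contains a half-plane. Since `X` has a pole at a zero of `Z`, a zero of `Z` in such a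
subset would be an isolated point of it, so there is none (`Z_ne_zero_of_mem`).
-/

namespace Level20

open Complex Filter Topology
open UpperHalfPlane hiding I
open scoped MatrixGroups ModularForm

/-! ### Vanishing of modular functions that vanish at the cusps -/

/-- The filter of neighbourhoods of the cusp `i∞` in `ℂ`. -/
abbrev atCusp : Filter ℂ := comap Complex.im atTop

/-- A level one modular function that is holomorphic on the upper half-plane and vanishes at `i∞` is
zero, being a cusp form of weight zero. -/
theorem eq_zero_of_levelOne_invariant {P : ℂ → ℂ}
    (hd : DifferentiableOn ℂ P {t | 0 < t.im})
    (hT : ∀ t : ℂ, 0 < t.im → P (t + 1) = P t)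
    (hS : ∀ t : ℂ, 0 < t.im → P (-1 / t) = P t)
    (h0 : Tendsto P atCusp (𝓝 0)) (t : ℂ) (ht : 0 < t.im) : P t = 0 := by
  have hT' : (fun τ : ℍ => P τ) ∣[(0 : ℤ)] ModularGroup.T = fun τ : ℍ => P τ := by
    ext τ
    rw [ModularForm.SL_slash_apply, UpperHalfPlane.modular_T_smul]
    simpa [add_comm] using hT τ τ.im_pos
  have hS' : (fun τ : ℍ => P τ) ∣[(0 : ℤ)] ModularGroup.S = fun τ : ℍ => P τ := by
    ext τ
    rw [ModularForm.SL_slash_apply, UpperHalfPlane.modular_S_smul]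
    have := hS τ τ.im_pos
    rw [neg_div, one_div] at this
    simpa [inv_neg] using this
  let f : CuspForm 𝒮ℒ 0 :=
    { toFun := fun τ : ℍ => P τ
      slash_action_eq' := by
        rintro _ ⟨A, rfl⟩
        exact SlashInvariantForm.slash_action_generators_SL2Z hS' hT' A
      holo' := by
        rw [UpperHalfPlane.mdifferentiable_iff]
        refine hd.congr fun z hz => ?_
        simp [ofComplex_apply_of_im_pos hz]
      zero_at_cusps' := fun hc => by
        rw [Subgroup.IsArithmetic.isCusp_iff_isCusp_SL2Z] at hc
        rw [OnePoint.isZeroAt_iff_forall_SL2Z hc]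
        intro γ _
        rw [SlashInvariantForm.slash_action_generators_SL2Z hS' hT']
        refine h0.comp (tendsto_comap_iff.mpr ?_)
        exact tendsto_comap }
  have hf : f = 0 := by
    have := CuspForm.rank_eq_zero_of_weight_lt_twelve (k := 0) (by norm_num)
    exact (rank_zero_iff.mp this).elim f 0
  exact congrArg (fun g : CuspForm 𝒮ℒ 0 => g ⟨t, ht⟩) hf

theorem im_neg_one_div_five_mul_pos {t : ℂ} (ht : 0 < t.im) : 0 < (-1 / (5 * t)).im := by
  have h0 : t ≠ 0 := by rintro rfl; simp at ht
  have : (-1 / (5 * t)) = -(5 * t)⁻¹ := by rw [neg_div, one_div]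
  rw [this, Complex.neg_im, Complex.inv_im, neg_div, neg_neg]
  apply div_pos
  · simpa using ht
  · exact Complex.normSq_pos.mpr (by simpa using h0)

theorem five_mul_sub_two_ne_zero {t : ℂ} (ht : 0 < t.im) : 5 * t - 2 ≠ 0 := by
  intro h
  have := congrArg Complex.im h
  simp at this
  linarith

theorem im_two_mul_sub_one_div_pos {t : ℂ} (ht : 0 < t.im) :
    0 < ((2 * t - 1) / (5 * t - 2)).im := by
  have h0 := five_mul_sub_two_ne_zero ht
  have : (2 * t - 1) / (5 * t - 2) = 2 / 5 - (5 * (5 * t - 2))⁻¹ := by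
    rw [mul_inv, div_eq_mul_inv]
    linear_combination (2 / 5 : ℂ) * mul_inv_cancel₀ h0
  rw [this, Complex.sub_im, Complex.inv_im]
  have h2 : ((2 : ℂ) / 5).im = 0 := by
    rw [show (2 : ℂ) / 5 = ((2 / 5 : ℝ) : ℂ) by push_cast; ring, Complex.ofReal_im]
  rw [h2, zero_sub, neg_div, neg_neg]
  apply div_pos
  · simpa using ht
  · exact Complex.normSq_pos.mpr (by simpa using h0)

/-- A function that is invariant under `t ↦ t + 1`, under the Fricke involution `t ↦ -1 / (5 t)`
and under the elliptic involution `t ↦ (2 t - 1) / (5 t - 2)`, and that vanishes at `i∞`, is zero.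
Its product over the six right cosets of `SL(2, ℤ)` in matrices of determinant five
is a level one cusp form of weight zero. -/
theorem eq_zero_of_levelFive_invariant {G : ℂ → ℂ}
    (hd : DifferentiableOn ℂ G {t | 0 < t.im})
    (hT : ∀ t : ℂ, 0 < t.im → G (t + 1) = G t)
    (hW : ∀ t : ℂ, 0 < t.im → G (-1 / (5 * t)) = G t)
    (hE : ∀ t : ℂ, 0 < t.im → G ((2 * t - 1) / (5 * t - 2)) = G t)
    (h0 : Tendsto G atCusp (𝓝 0)) (t : ℂ) (ht : 0 < t.im) : G t = 0 := by
  have hopen : IsOpen {t : ℂ | 0 < t.im} := isOpen_lt continuous_const Complex.continuous_im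
  have hconn : IsPreconnected {t : ℂ | 0 < t.im} :=
    (convex_halfSpace_im_gt 0).isPreconnected
  have hTm : ∀ t : ℂ, 0 < t.im → G (t - 1) = G t := fun t ht => by
    rw [← hT (t - 1) (by simpa using ht), sub_add_cancel]
  have im5 : ∀ (t : ℂ) (k : ℝ), ((t + k) / 5).im = t.im / 5 := fun t k => by
    rw [show (t + k) / 5 = ((1 / 5 : ℝ) : ℂ) * (t + k) by push_cast; ring, Complex.im_ofReal_mul]
    simp
    ring
  -- `t / (5 t + 1)` is the conjugate of the translation `t - 1` by the Fricke involution
  have hL : ∀ t : ℂ, 0 < t.im → G (t / (5 * t + 1)) = G t := fun t ht => by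
    have h1 : t ≠ 0 := by rintro rfl; simp at ht
    have h2 : 5 * t + 1 ≠ 0 := fun h => by
      have := congrArg Complex.im h
      simp at this; linarith
    have hp := im_neg_one_div_five_mul_pos ht
    rw [← hW t ht, ← hTm _ hp, ← hW (_ - 1) (by simpa using hp)]
    congr 1
    have h3 : -1 - 5 * t ≠ 0 := fun h => h2 (by linear_combination -h)
    have : 5 * (-1 / (5 * t) - 1) = (-1 - 5 * t) / t := by field_simp
    rw [this, div_div_eq_mul_div, div_eq_div_iff h2 h3]
    ring
  have hL' : ∀ t : ℂ, 0 < t.im → G (t / (1 - 5 * t)) = G t := fun t ht => by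
    have h1 : t ≠ 0 := by rintro rfl; simp at ht
    have h2 : 1 - 5 * t ≠ 0 := fun h => by
      have := congrArg Complex.im h
      simp at this; linarith
    have hp := im_neg_one_div_five_mul_pos ht
    rw [← hW t ht, ← hT _ hp, ← hW (_ + 1) (by simpa using hp)]
    congr 1
    have h3 : -1 + 5 * t ≠ 0 := fun h => h2 (by linear_combination -h)
    have : 5 * (-1 / (5 * t) + 1) = (-1 + 5 * t) / t := by field_simp
    rw [this, div_div_eq_mul_div, div_eq_div_iff h2 h3]
    ring
  -- the conjugate of the elliptic involution by the Fricke involution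
  have hE' : ∀ t : ℂ, 0 < t.im → G ((-2 * t - 1) / (5 * t + 2)) = G t := fun t ht => by
    have h1 : t ≠ 0 := by rintro rfl; simp at ht
    have h2 : 5 * t + 2 ≠ 0 := fun h => by
      have := congrArg Complex.im h
      simp at this; linarith
    have h2' : 2 * t + 1 ≠ 0 := fun h => by
      have := congrArg Complex.im h
      simp at this; linarith
    have hp := im_neg_one_div_five_mul_pos ht
    have hp2 := im_two_mul_sub_one_div_pos hp
    rw [← hW t ht, ← hE _ hp, ← hW _ hp2]
    congr 1
    have e1 : 5 * (-1 / (5 * t)) - 2 = -(2 * t + 1) / t := by field_simp; ring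
    have e2 : 2 * (-1 / (5 * t)) - 1 = -(5 * t + 2) / (5 * t) := by field_simp; ring
    rw [e1, e2]
    field_simp
    ring
  set Q : ℂ → ℂ := fun t => G ((t + (0 : ℝ)) / 5) * G ((t + (1 : ℝ)) / 5) * G ((t + (-1 : ℝ)) / 5) *
    G ((t + (2 : ℝ)) / 5) * G ((t + (-2 : ℝ)) / 5) with hQ
  have hdk : ∀ k : ℝ, DifferentiableOn ℂ (fun t : ℂ => G ((t + k) / 5)) {t | 0 < t.im} := fun k =>
    hd.comp (by fun_prop) fun t ht => by
      have : 0 < t.im := ht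
      change 0 < ((t + k) / 5).im
      rw [im5]; positivity
  have hP := eq_zero_of_levelOne_invariant (P := fun t => G t * Q t)
    (hd.mul (((((hdk 0).mul (hdk 1)).mul (hdk (-1))).mul (hdk 2)).mul (hdk (-2))))
    (fun t ht => by
      have ht' : 0 < t.im := ht
      have e : G ((t + 1 + (2 : ℝ)) / 5) = G ((t + (-2 : ℝ)) / 5) := by
        rw [← hT ((t + (-2 : ℝ)) / 5) (by rw [im5]; positivity)]
        congr 1; push_cast; ring
      simp only [hQ]
      rw [hT t ht, e]
      push_cast
      ring_nf)
    (fun t ht => by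
      have h1 : t ≠ 0 := by rintro rfl; simp at ht
      have p : ∀ k : ℝ, 0 < ((t + k) / 5).im := fun k => by rw [im5]; positivity
      have e0 : G (-1 / t) = G ((t + (0 : ℝ)) / 5) := by
        rw [← hW _ (p 0)]; congr 1
        rw [show 5 * ((t + ((0 : ℝ) : ℂ)) / 5) = t by push_cast; ring]
      have e1 : G ((-1 / t + (0 : ℝ)) / 5) = G t := by
        rw [← hW t ht]; congr 1; push_cast; field_simp; ring
      have e2 : G ((-1 / t + (1 : ℝ)) / 5) = G ((t + (-1 : ℝ)) / 5) := by
        rw [← hL _ (p _)]; congr 1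
        rw [show 5 * ((t + ((-1 : ℝ) : ℂ)) / 5) + 1 = t by push_cast; ring]
        push_cast; field_simp; ring
      have e3 : G ((-1 / t + (-1 : ℝ)) / 5) = G ((t + (1 : ℝ)) / 5) := by
        rw [← hL' _ (p _)]; congr 1
        rw [show 1 - 5 * ((t + ((1 : ℝ) : ℂ)) / 5) = -t by push_cast; ring]
        push_cast; field_simp; ring
      have e4 : G ((-1 / t + (2 : ℝ)) / 5) = G ((t + (2 : ℝ)) / 5) := by
        rw [← hE _ (p _)]; congr 1
        rw [show 5 * ((t + ((2 : ℝ) : ℂ)) / 5) - 2 = t by push_cast; ring]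
        push_cast; field_simp; ring
      have e5 : G ((-1 / t + (-2 : ℝ)) / 5) = G ((t + (-2 : ℝ)) / 5) := by
        rw [← hE' _ (p _)]; congr 1
        rw [show 5 * ((t + ((-2 : ℝ) : ℂ)) / 5) + 2 = t by push_cast; ring]
        push_cast; field_simp; ring
      simp only [hQ]
      rw [e0, e1, e2, e3, e4, e5]
      ring)
    (by
      have hk : ∀ k : ℝ, Tendsto (fun t : ℂ => G ((t + k) / 5)) atCusp (𝓝 0) := fun k =>
        h0.comp (tendsto_comap_iff.mpr (by
          have : (Complex.im ∘ fun t : ℂ => (t + k) / 5) = fun t : ℂ => t.im / 5 :=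
            funext fun t => im5 t k
          rw [this]
          exact tendsto_comap.atTop_div_const (by norm_num)))
      simpa [hQ] using h0.mul (((((hk 0).mul (hk 1)).mul (hk (-1))).mul (hk 2)).mul (hk (-2))))
  have han : ∀ {f : ℂ → ℂ}, DifferentiableOn ℂ f {t | 0 < t.im} →
      AnalyticOnNhd ℂ f {t | 0 < t.im} := fun hf => hf.analyticOnNhd hopen
  have key : ∀ k : ℝ, (∀ t : ℂ, 0 < t.im → G ((t + k) / 5) = 0) → G t = 0 := fun k hk => by
    have := hk (5 * t - k) (by simpa using ht)
    rwa [sub_add_cancel, mul_div_cancel_left₀ _ (by norm_num)] at this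
  have a01 := (hdk 0).mul (hdk 1)
  have a02 := a01.mul (hdk (-1))
  have a03 := a02.mul (hdk 2)
  rcases (han hd).eq_zero_or_eq_zero_of_mul_eq_zero (han (a03.mul (hdk (-2)))) hP hconn with h | h
  · exact h t ht
  rcases (han a03).eq_zero_or_eq_zero_of_mul_eq_zero (han (hdk (-2))) h hconn with h | h
  swap; · exact key _ h
  rcases (han a02).eq_zero_or_eq_zero_of_mul_eq_zero (han (hdk 2)) h hconn with h | h
  swap; · exact key _ h
  rcases (han a01).eq_zero_or_eq_zero_of_mul_eq_zero (han (hdk (-1))) h hconn with h | h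
  swap; · exact key _ h
  rcases (han (hdk 0)).eq_zero_or_eq_zero_of_mul_eq_zero (han (hdk 1)) h hconn with h | h
  · exact key _ h
  · exact key _ h

/-- Three functions that the generators of the level five group permute as the three even theta
constants are permuted, the first of which is bounded at `i∞` while the third vanishes there:
then the first is zero, as one sees from the product of the three. -/
theorem eq_zero_of_permuted {F₃ F₄ F₂ : ℂ → ℂ}
    (hd₃ : DifferentiableOn ℂ F₃ {t | 0 < t.im}) (hd₄ : DifferentiableOn ℂ F₄ {t | 0 < t.im})
    (hd₂ : DifferentiableOn ℂ F₂ {t | 0 < t.im})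
    (hT₃ : ∀ t : ℂ, 0 < t.im → F₃ (t + 1) = F₄ t) (hT₄ : ∀ t : ℂ, 0 < t.im → F₄ (t + 1) = F₃ t)
    (hT₂ : ∀ t : ℂ, 0 < t.im → F₂ (t + 1) = F₂ t)
    (hW₃ : ∀ t : ℂ, 0 < t.im → F₃ (-1 / (5 * t)) = F₃ t)
    (hW₄ : ∀ t : ℂ, 0 < t.im → F₄ (-1 / (5 * t)) = F₂ t)
    (hW₂ : ∀ t : ℂ, 0 < t.im → F₂ (-1 / (5 * t)) = F₄ t)
    (hE₃ : ∀ t : ℂ, 0 < t.im → F₃ ((2 * t - 1) / (5 * t - 2)) = F₃ t)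
    (hE₄ : ∀ t : ℂ, 0 < t.im → F₄ ((2 * t - 1) / (5 * t - 2)) = F₂ t)
    (hE₂ : ∀ t : ℂ, 0 < t.im → F₂ ((2 * t - 1) / (5 * t - 2)) = F₄ t)
    (hb : F₃ =O[atCusp] fun _ => (1 : ℂ)) (h0 : Tendsto F₂ atCusp (𝓝 0))
    (t : ℂ) (ht : 0 < t.im) : F₃ t = 0 := by
  have hopen : IsOpen {t : ℂ | 0 < t.im} := isOpen_lt continuous_const Complex.continuous_im
  have hconn : IsPreconnected {t : ℂ | 0 < t.im} :=
    (convex_halfSpace_im_gt 0).isPreconnected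
  have hpos : ∀ᶠ t : ℂ in atCusp, 0 < t.im := tendsto_comap.eventually (eventually_gt_atTop 0)
  have h4 : F₄ =O[atCusp] fun _ => (1 : ℂ) := by
    have : (fun t : ℂ => F₃ (t + 1)) =O[atCusp] fun _ => (1 : ℂ) :=
      hb.comp_tendsto (tendsto_comap_iff.mpr (by
        have : (Complex.im ∘ fun t : ℂ => t + 1) = Complex.im := funext fun t => by simp
        rw [this]; exact tendsto_comap))
    refine this.congr' ?_ EventuallyEq.rfl
    filter_upwards [hpos] with t ht using hT₃ t ht
  have hG := eq_zero_of_levelFive_invariant (G := fun t => F₃ t * F₄ t * F₂ t)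
    ((hd₃.mul hd₄).mul hd₂)
    (fun t ht => by simp only [hT₃ t ht, hT₄ t ht, hT₂ t ht]; ring)
    (fun t ht => by simp only [hW₃ t ht, hW₄ t ht, hW₂ t ht]; ring)
    (fun t ht => by simp only [hE₃ t ht, hE₄ t ht, hE₂ t ht]; ring)
    (by
      have h34 : (fun t => F₃ t * F₄ t) =O[atCusp] fun _ => (1 : ℂ) := by simpa using hb.mul h4
      exact isBoundedUnder_le_mul_tendsto_zero ((Asymptotics.isBigO_one_iff ℂ).mp h34) h0)
  have han : ∀ {f : ℂ → ℂ}, DifferentiableOn ℂ f {t | 0 < t.im} →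
      AnalyticOnNhd ℂ f {t | 0 < t.im} := fun hf => hf.analyticOnNhd hopen
  have h43 : (∀ t : ℂ, 0 < t.im → F₄ t = 0) → F₃ t = 0 := fun h => by
    rw [← hT₄ t ht]; exact h _ (by simpa using ht)
  rcases (han (hd₃.mul hd₄)).eq_zero_or_eq_zero_of_mul_eq_zero (han hd₂) hG hconn with h | h
  · rcases (han hd₃).eq_zero_or_eq_zero_of_mul_eq_zero (han hd₄) h hconn with h | h
    · exact h t ht
    · exact h43 h
  · refine h43 fun s hs => ?_
    rw [← hW₂ s hs]
    exact h _ (im_neg_one_div_five_mul_pos hs)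

/-! ### Transformation formulas of the theta constants and of the eta function -/

/-- The square of the theta constant `θ₃`. -/
noncomputable def thetaSq₃ (t : ℂ) : ℂ := jacobiTheta t ^ 2

/-- The square of the theta constant `θ₄`. -/
noncomputable def thetaSq₄ (t : ℂ) : ℂ := jacobiTheta (t + 1) ^ 2

/-- The square of the theta constant `θ₂`. -/
noncomputable def thetaSq₂ (t : ℂ) : ℂ := (cexp (Real.pi * I * t / 4) * jacobiTheta₂ (t / 2) t) ^ 2

theorem im_neg_one_div_pos {t : ℂ} (ht : 0 < t.im) : 0 < (-1 / t).im := by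
  have := im_neg_one_div_five_mul_pos (t := t / 5) (by
    rw [show t / 5 = ((1 / 5 : ℝ) : ℂ) * t by push_cast; ring, Complex.im_ofReal_mul]
    positivity)
  rwa [show 5 * (t / 5) = t by ring] at this

theorem jacobiTheta_add_one (t : ℂ) : jacobiTheta (t + 1) = jacobiTheta₂ (1 / 2) t := by
  refine tsum_congr fun n => ?_
  rw [jacobiTheta₂_term, mul_add, add_comm, Complex.exp_add, Complex.exp_add]
  congr 1
  obtain ⟨k, hk⟩ : Even (n ^ 2 - n) := by
    rw [show n ^ 2 - n = (n - 1) * ((n - 1) + 1) by ring]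
    exact Int.even_mul_succ_self _
  rw [Complex.exp_eq_exp_iff_exists_int]
  refine ⟨k, ?_⟩
  have : ((n : ℂ) ^ 2 - n) = k + k := by exact_mod_cast hk
  linear_combination Real.pi * I * this

theorem thetaSq₃_add_one (t : ℂ) : thetaSq₃ (t + 1) = thetaSq₄ t := rfl

theorem thetaSq₄_add_one (t : ℂ) : thetaSq₄ (t + 1) = thetaSq₃ t := by
  rw [thetaSq₄, thetaSq₃, show t + 1 + 1 = 2 + t by ring, jacobiTheta_two_add]

theorem thetaSq₂_add_one (t : ℂ) : thetaSq₂ (t + 1) = I * thetaSq₂ t := by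
  have h1 : jacobiTheta₂ ((t + 1) / 2) (t + 1) = jacobiTheta₂ (t / 2) t := by
    refine tsum_congr fun n => ?_
    rw [jacobiTheta₂_term, jacobiTheta₂_term, Complex.exp_eq_exp_iff_exists_int]
    obtain ⟨k, hk⟩ : Even (n ^ 2 + n) := by
      rw [show n ^ 2 + n = n * (n + 1) by ring]
      exact Int.even_mul_succ_self _
    refine ⟨k, ?_⟩
    have : ((n : ℂ) ^ 2 + n) = k + k := by exact_mod_cast hk
    linear_combination Real.pi * I * this
  have h2 : cexp (Real.pi * I * (t + 1) / 4) ^ 2 = I * cexp (Real.pi * I * t / 4) ^ 2 := by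
    rw [← Complex.exp_nat_mul, ← Complex.exp_nat_mul]
    nth_rw 2 [← Complex.exp_pi_div_two_mul_I]
    rw [← Complex.exp_add]
    congr 1
    push_cast
    ring
  rw [thetaSq₂, thetaSq₂, h1, mul_pow, h2]
  ring

theorem cpow_half_sq (w : ℂ) : (w ^ (1 / 2 : ℂ)) ^ 2 = w := by
  rw [← Complex.cpow_nat_mul]
  norm_num

theorem thetaSq₃_neg_one_div {t : ℂ} (ht : 0 < t.im) :
    thetaSq₃ (-1 / t) = -I * t * thetaSq₃ t := by
  have := jacobiTheta_S_smul ⟨t, ht⟩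
  rw [UpperHalfPlane.modular_S_smul] at this
  have e : -1 / t = (-t)⁻¹ := by rw [inv_neg, neg_div, one_div]
  rw [thetaSq₃, thetaSq₃, e]
  refine (congrArg (· ^ 2) this).trans ?_
  simp only [mul_pow, cpow_half_sq]

theorem thetaSq₄_neg_one_div {t : ℂ} (ht : 0 < t.im) :
    thetaSq₄ (-1 / t) = -I * t * thetaSq₂ t := by
  have h0 : t ≠ 0 := by rintro rfl; simp at ht
  rw [thetaSq₄, thetaSq₂, jacobiTheta_add_one, jacobiTheta₂_functional_equation]
  have e1 : -1 / (-1 / t) = t := by field_simp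
  have e2 : 1 / 2 / (-1 / t) = -(t / 2) := by field_simp
  have e3 : -Real.pi * I * (1 / 2) ^ 2 / (-1 / t) = Real.pi * I * t / 4 := by
    field_simp
    ring
  have e4 : -I * (-1 / t) = I / t := by ring
  rw [e1, e2, e3, e4, jacobiTheta₂_neg_left, mul_assoc, mul_pow, div_pow, cpow_half_sq]
  field_simp
  simp

theorem thetaSq₂_neg_one_div {t : ℂ} (ht : 0 < t.im) :
    thetaSq₂ (-1 / t) = -I * t * thetaSq₄ t := by
  have h0 : t ≠ 0 := by rintro rfl; simp at ht
  have := thetaSq₄_neg_one_div (im_neg_one_div_pos ht)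
  rw [show -1 / (-1 / t) = t by field_simp] at this
  rw [this]
  field_simp
  simp

theorem eta_sq_neg_one_div {t : ℂ} (ht : 0 < t.im) :
    ModularForm.eta (-1 / t) ^ 2 = -I * t * ModularForm.eta t ^ 2 := by
  have := ModularForm.eta_comp_eq_csqrt_I_inv (x := t) ht
  simp only [Function.comp, Pi.smul_apply, Pi.mul_apply, smul_eq_mul] at this
  have h := cpow_half_sq
  simp only [one_div] at h
  rw [this, mul_pow, mul_pow, inv_pow, Complex.sqrt, Complex.sqrt, h, h, inv_I]
  ring

theorem eta_sq_add_one (t : ℂ) :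
    ModularForm.eta (t + 1) ^ 2 = cexp (Real.pi * I / 6) * ModularForm.eta t ^ 2 := by
  have h : ∀ n, ModularForm.eta_q n (t + 1) = ModularForm.eta_q n t := fun n => by
    rw [ModularForm.eta_q_eq_pow, ModularForm.eta_q_eq_pow, mul_add, mul_one,
      Complex.exp_periodic]
  simp only [ModularForm.eta, h, mul_pow, Function.Periodic.qParam]
  rw [← Complex.exp_nat_mul, ← Complex.exp_nat_mul, ← mul_assoc, ← Complex.exp_add]
  congr 2
  push_cast
  ring

/-! ### Level five products and differential expressions of weight zero -/

/-- The product `f(t) f(5t)`. -/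
def prodFive (f : ℂ → ℂ) (t : ℂ) : ℂ := f t * f (5 * t)

theorem prodFive_neg_one_div {f g : ℂ → ℂ}
    (hS : ∀ t : ℂ, 0 < t.im → f (-1 / t) = -I * t * g t) {t : ℂ} (ht : 0 < t.im) :
    prodFive f (-1 / (5 * t)) = -(5 * t ^ 2) * prodFive g t := by
  have h0 : t ≠ 0 := by rintro rfl; simp at ht
  have e : 5 * (-1 / (5 * t)) = -1 / t := by field_simp
  rw [prodFive, prodFive, e, hS t ht, hS (5 * t) (by simpa using ht)]
  linear_combination (5 * t ^ 2 * g t * g (5 * t)) * I_sq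

/-- The involution `t ↦ (2 t - 1) / (5 t - 2)` is `S T⁻² S T² S` on `t`, and `5 t` is moved by
`T² S T⁻²`. -/
theorem prodFive_two_mul_sub_one_div {f g : ℂ → ℂ} {a b : ℂ} (hb : b ≠ 0) (hab : a ^ 2 = b ^ 2)
    (hf : ∀ t : ℂ, 0 < t.im → f (-1 / t) = -I * t * g t)
    (hg : ∀ t : ℂ, 0 < t.im → g (-1 / t) = -I * t * f t)
    (hfT : ∀ t : ℂ, f (t + 2) = a * f t) (hgT : ∀ t : ℂ, g (t + 2) = b * g t)
    {t : ℂ} (ht : 0 < t.im) :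
    prodFive f ((2 * t - 1) / (5 * t - 2)) = -(5 * t - 2) ^ 2 * prodFive g t := by
  have h0 : t ≠ 0 := by rintro rfl; simp at ht
  have h5 := five_mul_sub_two_ne_zero ht
  have h2 : 2 * t - 1 ≠ 0 := fun h => by
    have := congrArg Complex.im h
    simp at this; linarith
  have hσ := im_neg_one_div_pos ht
  have hσ2 : 0 < (-1 / t + 2).im := by simpa using hσ
  have e1 : -1 / t + 2 = (2 * t - 1) / t := by field_simp; ring
  obtain ⟨y, hy⟩ : ∃ y, y = -1 / (-1 / t + 2) - 2 := ⟨_, rfl⟩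
  have hy0 : 0 < y.im := by rw [hy]; simpa using im_neg_one_div_pos hσ2
  have hy2 : y + 2 = -1 / (-1 / t + 2) := by rw [hy]; ring
  have hyt : y * (2 * t - 1) = 2 - 5 * t := by
    rw [hy, e1]; field_simp; ring
  have hy0' : y ≠ 0 := by rintro rfl; simp at hy0
  have e2 : (2 * t - 1) / (5 * t - 2) = -1 / y := by
    rw [div_eq_div_iff h5 hy0']; linear_combination hyt
  have e3 : 5 * ((2 * t - 1) / (5 * t - 2)) = -1 / (5 * t - 2) + 2 := by
    rw [div_add' _ _ _ h5, mul_div_assoc']; congr 1; ring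
  -- with `y = T⁻² S T² S t`, the argument of `f` is `-1 / y`
  have h1 : f ((2 * t - 1) / (5 * t - 2)) * b = a * (I * (2 - 5 * t) * g t) := by
    have i1 : b * g y = -I * (-1 / t + 2) * (a * (-I * t * g t)) := by
      rw [← hgT, hy2, hg _ hσ2, hfT, hf t ht]
    rw [e2, hf y hy0, e1] at *
    have i2 : t * (b * g y) = (2 * t - 1) * a * t * (I ^ 2) * g t := by
      rw [i1]; field_simp
    have i3 : b * g y = -(2 * t - 1) * a * g t := by
      apply mul_left_cancel₀ h0
      rw [i2, I_sq]; ring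
    linear_combination (-I * y) * i3 + I * a * g t * hyt
  have h3 : f (5 * ((2 * t - 1) / (5 * t - 2))) * b = a * (-I * (5 * t - 2) * g (5 * t)) := by
    rw [e3, hfT, hf _ (by simpa using ht)]
    have := hgT (5 * t - 2)
    rw [sub_add_cancel] at this
    rw [this]; ring
  rw [prodFive, prodFive]
  apply mul_right_cancel₀ (pow_ne_zero 2 hb)
  linear_combination f (5 * ((2 * t - 1) / (5 * t - 2))) * b * h1 +
    a * (I * (2 - 5 * t) * g t) * h3 + (5 * t - 2) ^ 2 * g t * g (5 * t) * a ^ 2 * I_sq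
    - (5 * t - 2) ^ 2 * g t * g (5 * t) * hab

/-- The quotient by `z ^ 6` of the difference of the two sides of the differential equation for
`z / Z`; here `deriv / (π i)` is the derivation `q d/dq` for `q = exp (π i t)`. -/
noncomputable def firstForm (Z z : ℂ → ℂ) (t : ℂ) : ℂ :=
  (((Real.pi * I)⁻¹ * (Z t * deriv z t - z t * deriv Z t)) ^ 2 -
    z t ^ 2 * Z t * (Z t - 4 * z t) * (Z t ^ 2 - 12 * z t * Z t + 16 * z t ^ 2)) / z t ^ 6

/-- The quotient by `z ^ 4` of the difference of the two sides of the second order differential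
equation for `Z`, whose left side is a Rankin–Cohen bracket of `Z` with itself. -/
noncomputable def secondForm (Z z : ℂ → ℂ) (t : ℂ) : ℂ :=
  ((Real.pi * I)⁻¹ ^ 2 * (2 * Z t * deriv (deriv Z) t - 3 * deriv Z t ^ 2) -
    8 * Z t * z t * (Z t ^ 2 - 10 * Z t * z t + 18 * z t ^ 2)) / z t ^ 4

theorem isOpen_im_pos : IsOpen {t : ℂ | 0 < t.im} :=
  isOpen_lt continuous_const Complex.continuous_im

/-- The derivative of a function of weight two picks up a multiple of the function itself; here
`γ` is a Möbius transformation with derivative `j⁻²`, and `c` is the slope of `j`. -/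
theorem deriv_of_weight_two {γ j f g : ℂ → ℂ} {c κ : ℂ}
    (hγ : ∀ t : ℂ, 0 < t.im → 0 < (γ t).im)
    (hj0 : ∀ t : ℂ, 0 < t.im → j t ≠ 0)
    (hγ' : ∀ t : ℂ, 0 < t.im → HasDerivAt γ (1 / j t ^ 2) t)
    (hj' : ∀ t : ℂ, 0 < t.im → HasDerivAt j c t)
    (hf : DifferentiableOn ℂ f {t | 0 < t.im}) (hg : DifferentiableOn ℂ g {t | 0 < t.im})
    (h : ∀ t : ℂ, 0 < t.im → f (γ t) = κ * j t ^ 2 * g t) {t : ℂ} (ht : 0 < t.im) :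
    deriv f (γ t) = κ * (j t ^ 4 * deriv g t + 2 * c * j t ^ 3 * g t) := by
  have hfa := (hf.differentiableAt (isOpen_im_pos.mem_nhds (hγ t ht))).hasDerivAt
  have hga := (hg.differentiableAt (isOpen_im_pos.mem_nhds ht)).hasDerivAt
  have h1 := hfa.comp t (hγ' t ht)
  have h2 := (((hj' t ht).pow 2).const_mul κ).mul hga
  have h3 : (f ∘ γ) =ᶠ[𝓝 t] ((fun y => κ * (j ^ 2) y) * g) := by
    filter_upwards [isOpen_im_pos.mem_nhds ht] with s hs
    simpa using h s hs
  have h4 := h1.unique (h2.congr_of_eventuallyEq h3)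
  have hj := hj0 t ht
  simp only [Pi.pow_apply] at h4
  have : deriv f (γ t) = j t ^ 2 * (deriv f (γ t) * (1 / j t ^ 2)) := by field_simp
  rw [this, h4]
  push_cast
  ring

theorem deriv_deriv_of_weight_two {γ j f g : ℂ → ℂ} {c κ : ℂ}
    (hγ : ∀ t : ℂ, 0 < t.im → 0 < (γ t).im)
    (hj0 : ∀ t : ℂ, 0 < t.im → j t ≠ 0)
    (hγ' : ∀ t : ℂ, 0 < t.im → HasDerivAt γ (1 / j t ^ 2) t)
    (hj' : ∀ t : ℂ, 0 < t.im → HasDerivAt j c t)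
    (hf : DifferentiableOn ℂ f {t | 0 < t.im}) (hg : DifferentiableOn ℂ g {t | 0 < t.im})
    (h : ∀ t : ℂ, 0 < t.im → f (γ t) = κ * j t ^ 2 * g t) {t : ℂ} (ht : 0 < t.im) :
    deriv (deriv f) (γ t) = κ * (j t ^ 6 * deriv (deriv g) t + 6 * c * j t ^ 5 * deriv g t +
      6 * c ^ 2 * j t ^ 4 * g t) := by
  have hfa := ((hf.deriv isOpen_im_pos).differentiableAt
    (isOpen_im_pos.mem_nhds (hγ t ht))).hasDerivAt
  have hga := (hg.differentiableAt (isOpen_im_pos.mem_nhds ht)).hasDerivAt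
  have hga' := ((hg.deriv isOpen_im_pos).differentiableAt
    (isOpen_im_pos.mem_nhds ht)).hasDerivAt
  have h1 := hfa.comp t (hγ' t ht)
  have h2 := ((((hj' t ht).pow 4).mul hga').add
    ((((hj' t ht).pow 3).const_mul (2 * c)).mul hga)).const_mul κ
  have h4 := h1.unique (h2.congr_of_eventuallyEq (by
    filter_upwards [isOpen_im_pos.mem_nhds ht] with s hs
    simpa using deriv_of_weight_two hγ hj0 hγ' hj' hf hg h hs))
  have hj := hj0 t ht
  simp only [Pi.pow_apply] at h4
  have : deriv (deriv f) (γ t) = j t ^ 2 * (deriv (deriv f) (γ t) * (1 / j t ^ 2)) := by field_simp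
  rw [this, h4]
  push_cast
  ring

/-- Both differential expressions have weight zero: the terms containing the slope `c` cancel. The two
sides of the equations have different degrees in `Z` and `z`, all even, whence `κ² = 1`. -/
theorem forms_comp_eq {γ j Z Z' z z' : ℂ → ℂ} {c κ : ℂ}
    (hγ : ∀ t : ℂ, 0 < t.im → 0 < (γ t).im)
    (hj0 : ∀ t : ℂ, 0 < t.im → j t ≠ 0)
    (hγ' : ∀ t : ℂ, 0 < t.im → HasDerivAt γ (1 / j t ^ 2) t)
    (hj' : ∀ t : ℂ, 0 < t.im → HasDerivAt j c t) (hκ : κ ^ 2 = 1)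
    (hdZ : DifferentiableOn ℂ Z {t | 0 < t.im}) (hdZ' : DifferentiableOn ℂ Z' {t | 0 < t.im})
    (hdz : DifferentiableOn ℂ z {t | 0 < t.im}) (hdz' : DifferentiableOn ℂ z' {t | 0 < t.im})
    (hZ : ∀ t : ℂ, 0 < t.im → Z (γ t) = κ * j t ^ 2 * Z' t)
    (hz : ∀ t : ℂ, 0 < t.im → z (γ t) = κ * j t ^ 2 * z' t) (t : ℂ) (ht : 0 < t.im) :
    firstForm Z z (γ t) = firstForm Z' z' t ∧ secondForm Z z (γ t) = secondForm Z' z' t := by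
  have hκ4 : κ ^ 4 = 1 := by rw [show κ ^ 4 = (κ ^ 2) ^ 2 by ring, hκ, one_pow]
  have hκ6 : κ ^ 6 = 1 := by rw [show κ ^ 6 = (κ ^ 2) ^ 3 by ring, hκ, one_pow]
  have hj : j t ≠ 0 := hj0 t ht
  have hd : (κ * j t ^ 2 * z' t) ^ 4 = j t ^ 8 * z' t ^ 4 := by
    linear_combination j t ^ 8 * z' t ^ 4 * hκ4
  have hd6 : (κ * j t ^ 2 * z' t) ^ 6 = j t ^ 12 * z' t ^ 6 := by
    linear_combination j t ^ 12 * z' t ^ 6 * hκ6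
  constructor
  · rw [firstForm, firstForm, hZ t ht, hz t ht, deriv_of_weight_two hγ hj0 hγ' hj' hdZ hdZ' hZ ht,
      deriv_of_weight_two hγ hj0 hγ' hj' hdz hdz' hz ht, hd6,
      ← mul_div_mul_left _ (z' t ^ 6) (pow_ne_zero 12 hj)]
    congr 1
    generalize (↑Real.pi * I)⁻¹ = p
    generalize deriv z' t = z1
    generalize deriv Z' t = Z1
    generalize Z' t = Z0
    generalize z' t = z0
    generalize j t = y
    linear_combination (y ^ 12 * (p * (Z0 * z1 - z0 * Z1)) ^ 2) * hκ4 -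
      (y ^ 12 * (z0 ^ 2 * Z0 * (Z0 - 4 * z0) * (Z0 ^ 2 - 12 * z0 * Z0 + 16 * z0 ^ 2))) * hκ6
  · rw [secondForm, secondForm, hZ t ht, hz t ht,
      deriv_of_weight_two hγ hj0 hγ' hj' hdZ hdZ' hZ ht,
      deriv_deriv_of_weight_two hγ hj0 hγ' hj' hdZ hdZ' hZ ht, hd,
      ← mul_div_mul_left _ (z' t ^ 4) (pow_ne_zero 8 hj)]
    congr 1
    generalize (↑Real.pi * I)⁻¹ = p
    generalize deriv (deriv Z') t = Z2
    generalize deriv Z' t = Z1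
    generalize Z' t = Z0
    generalize z' t = z0
    generalize j t = y
    linear_combination (y ^ 8 * p ^ 2 * (2 * Z0 * Z2 - 3 * Z1 ^ 2)) * hκ -
      (y ^ 8 * (8 * Z0 * z0 * (Z0 ^ 2 - 10 * Z0 * z0 + 18 * z0 ^ 2))) * hκ4

/-- The eta product `η(t)² η(5t)²`. -/
noncomputable def etaProd : ℂ → ℂ := prodFive fun t => ModularForm.eta t ^ 2

theorem differentiableOn_prodFive {f : ℂ → ℂ} (hf : DifferentiableOn ℂ f {t | 0 < t.im}) :
    DifferentiableOn ℂ (prodFive f) {t | 0 < t.im} :=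
  hf.mul (hf.comp (by fun_prop) fun t ht => by simpa using ht)

theorem differentiableOn_thetaSq₃ : DifferentiableOn ℂ thetaSq₃ {t | 0 < t.im} := fun _ ht =>
  ((differentiableAt_jacobiTheta ht).pow 2).differentiableWithinAt

theorem differentiableOn_thetaSq₄ : DifferentiableOn ℂ thetaSq₄ {t | 0 < t.im} :=
  differentiableOn_thetaSq₃.comp (by fun_prop) fun t ht => by simpa using ht

theorem differentiableOn_thetaSq₂ : DifferentiableOn ℂ thetaSq₂ {t | 0 < t.im} := fun t ht => by
  have h1 : DifferentiableAt ℂ (fun t : ℂ => jacobiTheta₂ (t / 2) t) t :=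
    (hasFDerivAt_jacobiTheta₂ (t / 2) ht).differentiableAt.comp t
      (f := fun t : ℂ => (t / 2, t)) (by fun_prop)
  exact (((by fun_prop : DifferentiableAt ℂ (fun t : ℂ => cexp (Real.pi * I * t / 4)) t).mul
    h1).pow 2).differentiableWithinAt

theorem differentiableOn_eta_sq :
    DifferentiableOn ℂ (fun t => ModularForm.eta t ^ 2) {t | 0 < t.im} := fun _ ht =>
  ((ModularForm.differentiableAt_eta_of_mem_upperHalfPlaneSet ht).pow 2).differentiableWithinAt

theorem etaProd_ne_zero {t : ℂ} (ht : 0 < t.im) : etaProd t ≠ 0 :=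
  mul_ne_zero (pow_ne_zero 2 (ModularForm.eta_ne_zero ht))
    (pow_ne_zero 2 (ModularForm.eta_ne_zero (by simpa using ht)))

theorem differentiableOn_forms {Z z : ℂ → ℂ} (hZ : DifferentiableOn ℂ Z {t | 0 < t.im})
    (hz : DifferentiableOn ℂ z {t | 0 < t.im}) (h0 : ∀ t : ℂ, 0 < t.im → z t ≠ 0) :
    DifferentiableOn ℂ (firstForm Z z) {t | 0 < t.im} ∧
      DifferentiableOn ℂ (secondForm Z z) {t | 0 < t.im} := by
  have hZ' := hZ.deriv isOpen_im_pos
  have hZ'' := hZ'.deriv isOpen_im_pos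
  have hz' := hz.deriv isOpen_im_pos
  constructor
  · refine DifferentiableOn.div ?_ (hz.pow 6) fun t ht => pow_ne_zero 6 (h0 t ht)
    fun_prop
  · refine DifferentiableOn.div ?_ (hz.pow 4) fun t ht => pow_ne_zero 4 (h0 t ht)
    fun_prop

theorem etaProd_add_one (t : ℂ) : etaProd (t + 1) = -etaProd t := by
  have h := eta_sq_add_one
  have h5 : ModularForm.eta (5 * (t + 1)) ^ 2 =
      cexp (Real.pi * I / 6) ^ 5 * ModularForm.eta (5 * t) ^ 2 := by
    rw [show 5 * (t + 1) = 5 * t + 1 + 1 + 1 + 1 + 1 by ring, h, h, h, h, h]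
    ring
  have h6 : cexp (Real.pi * I / 6) ^ 6 = -1 := by
    rw [← Complex.exp_nat_mul, ← Complex.exp_pi_mul_I]
    congr 1
    push_cast
    ring
  rw [etaProd, prodFive, prodFive, h5, h]
  linear_combination ModularForm.eta t ^ 2 * ModularForm.eta (5 * t) ^ 2 * h6

theorem prodFive_thetaSq₃_add_one (t : ℂ) :
    prodFive thetaSq₃ (t + 1) = prodFive thetaSq₄ t := by
  rw [prodFive, prodFive, show 5 * (t + 1) = 5 * t + 1 + 1 + 1 + 1 + 1 by ring]
  simp only [thetaSq₃_add_one, thetaSq₄_add_one]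

theorem prodFive_thetaSq₄_add_one (t : ℂ) :
    prodFive thetaSq₄ (t + 1) = prodFive thetaSq₃ t := by
  rw [prodFive, prodFive, show 5 * (t + 1) = 5 * t + 1 + 1 + 1 + 1 + 1 by ring]
  simp only [thetaSq₃_add_one, thetaSq₄_add_one]

theorem prodFive_thetaSq₂_add_one (t : ℂ) :
    prodFive thetaSq₂ (t + 1) = -prodFive thetaSq₂ t := by
  rw [prodFive, prodFive, show 5 * (t + 1) = 5 * t + 1 + 1 + 1 + 1 + 1 by ring]
  simp only [thetaSq₂_add_one]
  linear_combination (I ^ 4 - I ^ 2 + 1) * thetaSq₂ t * thetaSq₂ (5 * t) * I_sq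

section Generators

variable {Z Z' z z' : ℂ → ℂ}
  (hdZ : DifferentiableOn ℂ Z {t | 0 < t.im}) (hdZ' : DifferentiableOn ℂ Z' {t | 0 < t.im})
  (hdz : DifferentiableOn ℂ z {t | 0 < t.im}) (hdz' : DifferentiableOn ℂ z' {t | 0 < t.im})

include hdZ hdZ' hdz hdz'

/-- The case of `t ↦ t + 1`. -/
theorem forms_add_one {κ : ℂ} (hκ : κ ^ 2 = 1)
    (hZ : ∀ t : ℂ, 0 < t.im → Z (t + 1) = κ * Z' t)
    (hz : ∀ t : ℂ, 0 < t.im → z (t + 1) = κ * z' t) (t : ℂ) (ht : 0 < t.im) :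
    firstForm Z z (t + 1) = firstForm Z' z' t ∧ secondForm Z z (t + 1) = secondForm Z' z' t :=
  forms_comp_eq (γ := fun t => t + 1) (j := fun _ => 1) (c := 0) (κ := κ)
    (fun t ht => by simpa using ht) (fun t ht => one_ne_zero)
    (fun t ht => by simpa using (hasDerivAt_id t).add_const 1)
    (fun t ht => hasDerivAt_const t _) hκ hdZ hdZ' hdz hdz'
    (fun t ht => by simpa using hZ t ht) (fun t ht => by simpa using hz t ht) t ht

/-- The case of the Fricke involution; the automorphy factor normalised to determinant one is
`j t = √5 t`. -/
theorem forms_neg_one_div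
    (hZ : ∀ t : ℂ, 0 < t.im → Z (-1 / (5 * t)) = -(5 * t ^ 2) * Z' t)
    (hz : ∀ t : ℂ, 0 < t.im → z (-1 / (5 * t)) = -(5 * t ^ 2) * z' t) (t : ℂ) (ht : 0 < t.im) :
    firstForm Z z (-1 / (5 * t)) = firstForm Z' z' t ∧
      secondForm Z z (-1 / (5 * t)) = secondForm Z' z' t := by
  have s5 : ((Real.sqrt 5 : ℝ) : ℂ) ^ 2 = 5 := by
    exact_mod_cast congrArg ((↑) : ℝ → ℂ) (Real.sq_sqrt (show (0 : ℝ) ≤ 5 by norm_num))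
  have s0 : ((Real.sqrt 5 : ℝ) : ℂ) ≠ 0 := fun h => by rw [h] at s5; norm_num at s5
  have ht0 : ∀ t : ℂ, 0 < t.im → t ≠ 0 := by rintro _ ht rfl; simp at ht
  have hj : ∀ t : ℂ, (((Real.sqrt 5 : ℝ) : ℂ) * t) ^ 2 = 5 * t ^ 2 := fun t => by
    rw [mul_pow, s5]
  refine forms_comp_eq (γ := fun t => -1 / (5 * t)) (j := fun t => ((Real.sqrt 5 : ℝ) : ℂ) * t)
    (c := ((Real.sqrt 5 : ℝ) : ℂ)) (κ := -1)
    (fun t ht => im_neg_one_div_five_mul_pos ht) (fun t ht => mul_ne_zero s0 (ht0 t ht))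
    (fun t ht => ?_)
    (fun t ht => by simpa using (hasDerivAt_id t).const_mul ((Real.sqrt 5 : ℝ) : ℂ))
    (by norm_num) hdZ hdZ' hdz hdz'
    (fun t ht => ?_) (fun t ht => ?_) t ht
  · have h0 := ht0 t ht
    have := ((hasDerivAt_id t).const_mul (5 : ℂ)).inv (by simpa using h0)
    have := this.neg
    simp only [id] at this
    refine (this.congr_deriv ?_).congr_of_eventuallyEq (Eventually.of_forall fun s => ?_)
    · rw [hj]; field_simp
    · simp [neg_div]
  · rw [hZ t ht, hj]; ring
  · rw [hz t ht, hj]; ring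

/-- The case of the elliptic involution. -/
theorem forms_two_mul_sub_one_div
    (hZ : ∀ t : ℂ, 0 < t.im → Z ((2 * t - 1) / (5 * t - 2)) = -(5 * t - 2) ^ 2 * Z' t)
    (hz : ∀ t : ℂ, 0 < t.im → z ((2 * t - 1) / (5 * t - 2)) = -(5 * t - 2) ^ 2 * z' t)
    (t : ℂ) (ht : 0 < t.im) :
    firstForm Z z ((2 * t - 1) / (5 * t - 2)) = firstForm Z' z' t ∧
      secondForm Z z ((2 * t - 1) / (5 * t - 2)) = secondForm Z' z' t := by
  have hl : ∀ (a b t : ℂ), HasDerivAt (fun t : ℂ => a * t - b) a t := fun a b t => by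
    simpa using ((hasDerivAt_id t).const_mul a).sub_const b
  refine forms_comp_eq (γ := fun t => (2 * t - 1) / (5 * t - 2)) (j := fun t => 5 * t - 2)
    (c := 5) (κ := -1)
    (fun t ht => im_two_mul_sub_one_div_pos ht) (fun t ht => five_mul_sub_two_ne_zero ht)
    (fun t ht => ?_) (fun t ht => hl 5 2 t)
    (by norm_num) hdZ hdZ' hdz hdz'
    (fun t ht => ?_) (fun t ht => ?_) t ht
  · refine ((hl 2 1 t).div (hl 5 2 t) (five_mul_sub_two_ne_zero ht)).congr_deriv ?_
    congr 1
    ring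
  · rw [hZ t ht]; ring
  · rw [hz t ht]; ring

end Generators

theorem etaProd_neg_one_div {t : ℂ} (ht : 0 < t.im) :
    etaProd (-1 / (5 * t)) = -(5 * t ^ 2) * etaProd t :=
  prodFive_neg_one_div (fun _ h => eta_sq_neg_one_div h) ht

theorem etaProd_two_mul_sub_one_div {t : ℂ} (ht : 0 < t.im) :
    etaProd ((2 * t - 1) / (5 * t - 2)) = -(5 * t - 2) ^ 2 * etaProd t := by
  have h : ∀ t, ModularForm.eta (t + 2) ^ 2 =
      cexp (Real.pi * I / 6) ^ 2 * ModularForm.eta t ^ 2 := fun t => by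
    rw [show t + 2 = t + 1 + 1 by ring, eta_sq_add_one, eta_sq_add_one]; ring
  exact prodFive_two_mul_sub_one_div (pow_ne_zero 2 (Complex.exp_ne_zero _)) rfl
    (fun _ h => eta_sq_neg_one_div h) (fun _ h => eta_sq_neg_one_div h) h h ht

theorem thetaSq₃_add_two (t : ℂ) : thetaSq₃ (t + 2) = 1 * thetaSq₃ t := by
  rw [show t + 2 = t + 1 + 1 by ring, thetaSq₃_add_one, thetaSq₄_add_one, one_mul]

theorem thetaSq₄_add_two (t : ℂ) : thetaSq₄ (t + 2) = 1 * thetaSq₄ t := by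
  rw [show t + 2 = t + 1 + 1 by ring, thetaSq₄_add_one, thetaSq₃_add_one, one_mul]

theorem thetaSq₂_add_two (t : ℂ) : thetaSq₂ (t + 2) = -1 * thetaSq₂ t := by
  rw [show t + 2 = t + 1 + 1 by ring, thetaSq₂_add_one, thetaSq₂_add_one, ← I_sq]; ring

/-- The three level five products of theta constants, taken with `z`, `-z`, `-z` for `θ₃`, `θ₄`, `θ₂`,
are permuted by the generators, so each differential equation for `θ₃` follows from bounds for `θ₃`
and `θ₂` at `i∞`. The signs absorb those of the translation `t ↦ t + 1`. -/
theorem firstForm_secondForm_permuted :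
    let Z₃ := prodFive thetaSq₃; let Z₂ := prodFive thetaSq₂
    (firstForm Z₃ etaProd =O[atCusp] (fun _ => (1 : ℂ)) →
      Tendsto (firstForm Z₂ (-etaProd)) atCusp (𝓝 0) →
      ∀ t : ℂ, 0 < t.im → firstForm Z₃ etaProd t = 0) ∧
    (secondForm Z₃ etaProd =O[atCusp] (fun _ => (1 : ℂ)) →
      Tendsto (secondForm Z₂ (-etaProd)) atCusp (𝓝 0) →
      ∀ t : ℂ, 0 < t.im → secondForm Z₃ etaProd t = 0) := by
  intro Z₃ Z₂
  have d₃ := differentiableOn_prodFive differentiableOn_thetaSq₃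
  have d₄ := differentiableOn_prodFive differentiableOn_thetaSq₄
  have d₂ := differentiableOn_prodFive differentiableOn_thetaSq₂
  have dz : DifferentiableOn ℂ etaProd {t | 0 < t.im} :=
    differentiableOn_prodFive differentiableOn_eta_sq
  have z0 : ∀ t : ℂ, 0 < t.im → etaProd t ≠ 0 := fun t => etaProd_ne_zero
  have z0' : ∀ t : ℂ, 0 < t.im → (-etaProd) t ≠ 0 := fun t ht => neg_ne_zero.mpr (z0 t ht)
  have D₃ := differentiableOn_forms d₃ dz z0
  have D₄ := differentiableOn_forms d₄ dz.neg z0'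
  have D₂ := differentiableOn_forms d₂ dz.neg z0'
  have T₃ := forms_add_one d₃ d₄ dz dz.neg (κ := 1) (by norm_num)
    (fun t _ => by rw [prodFive_thetaSq₃_add_one, one_mul])
    (fun t _ => by rw [etaProd_add_one, one_mul, Pi.neg_apply])
  have T₄ := forms_add_one d₄ d₃ dz.neg dz (κ := 1) (by norm_num)
    (fun t _ => by rw [prodFive_thetaSq₄_add_one, one_mul])
    (fun t _ => by rw [Pi.neg_apply, etaProd_add_one, one_mul, neg_neg])
  have T₂ := forms_add_one d₂ d₂ dz.neg dz.neg (κ := -1) (by norm_num)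
    (fun t _ => by rw [prodFive_thetaSq₂_add_one]; ring)
    (fun t _ => by rw [Pi.neg_apply, etaProd_add_one, Pi.neg_apply]; ring)
  have zW : ∀ t : ℂ, 0 < t.im → (-etaProd) (-1 / (5 * t)) = -(5 * t ^ 2) * (-etaProd) t :=
    fun t ht => by rw [Pi.neg_apply, Pi.neg_apply, etaProd_neg_one_div ht]; ring
  have W₃ := forms_neg_one_div d₃ d₃ dz dz
    (fun t ht => prodFive_neg_one_div (fun _ h => thetaSq₃_neg_one_div h) ht)
    (fun t ht => etaProd_neg_one_div ht)
  have W₄ := forms_neg_one_div d₄ d₂ dz.neg dz.neg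
    (fun t ht => prodFive_neg_one_div (fun _ h => thetaSq₄_neg_one_div h) ht) zW
  have W₂ := forms_neg_one_div d₂ d₄ dz.neg dz.neg
    (fun t ht => prodFive_neg_one_div (fun _ h => thetaSq₂_neg_one_div h) ht) zW
  have zE : ∀ t : ℂ, 0 < t.im →
      (-etaProd) ((2 * t - 1) / (5 * t - 2)) = -(5 * t - 2) ^ 2 * (-etaProd) t :=
    fun t ht => by rw [Pi.neg_apply, Pi.neg_apply, etaProd_two_mul_sub_one_div ht]; ring
  have E₃ := forms_two_mul_sub_one_div d₃ d₃ dz dz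
    (fun t ht => prodFive_two_mul_sub_one_div one_ne_zero rfl (fun _ h => thetaSq₃_neg_one_div h)
      (fun _ h => thetaSq₃_neg_one_div h) thetaSq₃_add_two thetaSq₃_add_two ht)
    (fun t ht => etaProd_two_mul_sub_one_div ht)
  have E₄ := forms_two_mul_sub_one_div d₄ d₂ dz.neg dz.neg
    (fun t ht => prodFive_two_mul_sub_one_div (by norm_num) (by norm_num)
      (fun _ h => thetaSq₄_neg_one_div h)
      (fun _ h => thetaSq₂_neg_one_div h) thetaSq₄_add_two thetaSq₂_add_two ht) zE
  have E₂ := forms_two_mul_sub_one_div d₂ d₄ dz.neg dz.neg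
    (fun t ht => prodFive_two_mul_sub_one_div (by norm_num) (by norm_num)
      (fun _ h => thetaSq₂_neg_one_div h)
      (fun _ h => thetaSq₄_neg_one_div h) thetaSq₂_add_two thetaSq₄_add_two ht) zE
  exact ⟨eq_zero_of_permuted D₃.1 D₄.1 D₂.1 (fun t ht => (T₃ t ht).1) (fun t ht => (T₄ t ht).1)
      (fun t ht => (T₂ t ht).1) (fun t ht => (W₃ t ht).1) (fun t ht => (W₄ t ht).1)
      (fun t ht => (W₂ t ht).1) (fun t ht => (E₃ t ht).1) (fun t ht => (E₄ t ht).1)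
      (fun t ht => (E₂ t ht).1),
    eq_zero_of_permuted D₃.2 D₄.2 D₂.2 (fun t ht => (T₃ t ht).2) (fun t ht => (T₄ t ht).2)
      (fun t ht => (T₂ t ht).2) (fun t ht => (W₃ t ht).2) (fun t ht => (W₄ t ht).2)
      (fun t ht => (W₂ t ht).2) (fun t ht => (E₃ t ht).2) (fun t ht => (E₄ t ht).2)
      (fun t ht => (E₂ t ht).2)⟩

/-! ### Expansions at the cusp -/

/-- The local parameter `q = exp (π i t)` at the cusp `i∞`. -/
noncomputable def cuspParam (t : ℂ) : ℂ := cexp (Real.pi * I * t)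

/-- The Euler operator `q d/dq`. -/
noncomputable def euler (F : ℂ → ℂ) (q : ℂ) : ℂ := q * deriv F q

theorem norm_cuspParam (t : ℂ) : ‖cuspParam t‖ = Real.exp (-Real.pi * t.im) := by
  rw [cuspParam, Complex.norm_exp]
  congr 1
  simp

theorem cuspParam_ne_zero (t : ℂ) : cuspParam t ≠ 0 := Complex.exp_ne_zero _

theorem tendsto_cuspParam : Tendsto cuspParam atCusp (𝓝 0) := by
  rw [tendsto_zero_iff_norm_tendsto_zero]
  simp only [norm_cuspParam]
  refine Real.tendsto_exp_atBot.comp ?_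
  exact tendsto_comap.const_mul_atTop_of_neg (by simpa using Real.pi_pos)

theorem eventually_im_pos : ∀ᶠ t : ℂ in atCusp, 0 < t.im :=
  tendsto_comap.eventually (eventually_gt_atTop 0)

theorem eventually_atCusp_eventually_nhds {p : ℂ → Prop} (h : ∀ᶠ t in atCusp, p t) :
    ∀ᶠ t in atCusp, ∀ᶠ s in 𝓝 t, p s := by
  obtain ⟨U, hU, hp⟩ := eventually_comap.mp h |> fun h => h.exists_mem
  obtain ⟨C, hC⟩ := mem_atTop_sets.mp hU
  refine (tendsto_comap.eventually (eventually_gt_atTop C)).mono fun t ht => ?_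
  filter_upwards [(isOpen_lt continuous_const Complex.continuous_im).mem_nhds ht] with s hs
  exact hp _ (hC _ (le_of_lt hs)) s rfl

theorem hasDerivAt_cuspParam (t : ℂ) :
    HasDerivAt cuspParam (Real.pi * I * cuspParam t) t := by
  have := ((hasDerivAt_id t).const_mul (Real.pi * I : ℂ)).cexp
  simp only [id, mul_one] at this
  exact this.congr_deriv (mul_comm _ _)

theorem _root_.AnalyticAt.euler {F : ℂ → ℂ} {q : ℂ} (hF : AnalyticAt ℂ F q) :
    AnalyticAt ℂ (Level20.euler F) q :=
  analyticAt_id.mul hF.deriv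

/-- On expansions at the cusp, `deriv` is `π i` times the Euler operator. The constant `c` allows the
lemma to be iterated. -/
theorem deriv_eq_euler {f F : ℂ → ℂ} (hF : AnalyticAt ℂ F 0) (c : ℂ)
    (h : ∀ᶠ t in atCusp, f t = c * F (cuspParam t)) :
    ∀ᶠ t in atCusp, deriv f t = c * (Real.pi * I) * euler F (cuspParam t) := by
  filter_upwards [tendsto_cuspParam.eventually hF.eventually_analyticAt,
    eventually_atCusp_eventually_nhds h] with t ht hft
  have h1 : HasDerivAt (fun s => c * F (cuspParam s))
      (c * (deriv F (cuspParam t) * (Real.pi * I * cuspParam t))) t :=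
    (ht.differentiableAt.hasDerivAt.comp t (hasDerivAt_cuspParam t)).const_mul c
  rw [(h1.congr_of_eventuallyEq hft).deriv, euler]
  ring

/-- Congruence modulo `q ^ k` of germs of analytic functions at the origin. -/
def CongrMod (k : ℕ) (F G : ℂ → ℂ) : Prop :=
  AnalyticAt ℂ G 0 ∧ ∃ r, AnalyticAt ℂ r 0 ∧ ∀ᶠ q in 𝓝 0, F q = G q + q ^ k * r q

namespace CongrMod

variable {k : ℕ} {F G F' G' : ℂ → ℂ}

theorem refl (hG : AnalyticAt ℂ G 0) : CongrMod k G G :=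
  ⟨hG, 0, analyticAt_const, Eventually.of_forall fun q => by simp⟩

theorem add (h : CongrMod k F G) (h' : CongrMod k F' G') :
    CongrMod k (fun q => F q + F' q) fun q => G q + G' q := by
  obtain ⟨hG, r, hr, e⟩ := h
  obtain ⟨hG', r', hr', e'⟩ := h'
  refine ⟨hG.add hG', r + r', hr.add hr', ?_⟩
  filter_upwards [e, e'] with q h h'
  simp only [h, h', Pi.add_apply]
  ring

theorem mul (h : CongrMod k F G) (h' : CongrMod k F' G') :
    CongrMod k (fun q => F q * F' q) fun q => G q * G' q := by
  obtain ⟨hG, r, hr, e⟩ := h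
  obtain ⟨hG', r', hr', e'⟩ := h'
  refine ⟨hG.mul hG', fun q => r q * G' q + G q * r' q + q ^ k * r q * r' q, by fun_prop, ?_⟩
  filter_upwards [e, e'] with q h h'
  simp only [h, h']
  ring

theorem const_mul (c : ℂ) (h : CongrMod k F G) :
    CongrMod k (fun q => c * F q) fun q => c * G q :=
  (refl analyticAt_const).mul h

theorem sub (h : CongrMod k F G) (h' : CongrMod k F' G') :
    CongrMod k (fun q => F q - F' q) fun q => G q - G' q := by
  simpa [sub_eq_add_neg] using h.add (h'.const_mul (-1))

theorem pow (h : CongrMod k F G) (n : ℕ) :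
    CongrMod k (fun q => F q ^ n) fun q => G q ^ n := by
  induction n with
  | zero => simpa using refl (k := k) analyticAt_const
  | succ n ih => simpa [pow_succ] using ih.mul h

/-- Unlike `d/dq`, the Euler operator loses no order of approximation. -/
theorem euler (h : CongrMod k F G) : CongrMod k (euler F) (euler G) := by
  obtain ⟨hG, r, hr, e⟩ := h
  refine ⟨hG.euler, fun q => k * r q + Level20.euler r q, ?_, ?_⟩
  · have := hr.euler
    fun_prop
  · filter_upwards [e.eventually_nhds, hG.eventually_analyticAt, hr.eventually_analyticAt]
      with q hq hGq hrq
    have h1 := hGq.differentiableAt.hasDerivAt.add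
      (((hasDerivAt_id q).pow k).mul hrq.differentiableAt.hasDerivAt)
    rw [Level20.euler, (h1.congr_of_eventuallyEq hq).deriv, Level20.euler, Level20.euler]
    rcases k with _ | k
    · simp; ring
    · simp only [id, Pi.pow_apply, Nat.add_sub_cancel]
      push_cast
      ring

/-- If the model of `F` is itself divisible by `q ^ k`, then so is `F`. -/
theorem exists_eq_mul {P : ℂ → ℂ} (h : CongrMod k F fun q => q ^ k * P q)
    (hP : AnalyticAt ℂ P 0) :
    ∃ r, AnalyticAt ℂ r 0 ∧ ∀ᶠ q in 𝓝 0, F q = q ^ k * r q := by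
  obtain ⟨-, r, hr, e⟩ := h
  exact ⟨P + r, hP.add hr, by filter_upwards [e] with q h; rw [h, Pi.add_apply]; ring⟩

/-- Terms of the model that are divisible by `q ^ k` may be dropped. -/
theorem trans_poly {P : ℂ → ℂ} (h : CongrMod k F fun q => G q + q ^ k * P q)
    (hG : AnalyticAt ℂ G 0) (hP : AnalyticAt ℂ P 0) : CongrMod k F G := by
  obtain ⟨-, r, hr, e⟩ := h
  exact ⟨hG, P + r, hP.add hr, by filter_upwards [e] with q h; rw [h, Pi.add_apply]; ring⟩

end CongrMod

theorem analyticAt_tsum_pow {e : ℕ → ℕ} (he : ∀ n, n ≤ e n) :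
    AnalyticAt ℂ (fun q : ℂ => ∑' n, q ^ e n) 0 ∧
      ∀ q : ℂ, ‖q‖ < 1 → Summable fun n => q ^ e n := by
  have hs : ∀ q : ℂ, ‖q‖ < 1 → Summable fun n => q ^ e n := fun q hq => by
    refine Summable.of_norm_bounded (summable_geometric_of_lt_one (norm_nonneg q) hq) fun n => ?_
    rw [norm_pow]
    exact pow_le_pow_of_le_one (norm_nonneg q) hq.le (he n)
  refine ⟨?_, hs⟩
  have : DifferentiableOn ℂ (fun q : ℂ => ∑' n, q ^ e n) (Metric.ball 0 (1 / 2)) := by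
    refine differentiableOn_tsum_of_summable_norm
      (summable_geometric_of_lt_one (r := 1 / 2) (by norm_num) (by norm_num))
      (fun n => by fun_prop) Metric.isOpen_ball fun n q hq => ?_
    have hq : ‖q‖ < 1 / 2 := by simpa using hq
    rw [norm_pow]
    exact (pow_le_pow_of_le_one (norm_nonneg q) (by linarith) (he n)).trans
      (pow_le_pow_left₀ (norm_nonneg q) hq.le n)
  exact this.analyticAt (Metric.ball_mem_nhds 0 (by norm_num))

/-- The theta series `∑ q ^ (n²)`, the sum being over all integers. -/
noncomputable def thetaSeries (q : ℂ) : ℂ := 1 + 2 * ∑' n : ℕ, q ^ ((n + 1) ^ 2)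

/-- The theta series `∑ q ^ (n² + n)`, the sum being over all integers. -/
noncomputable def thetaSeries₂ (q : ℂ) : ℂ := 2 * ∑' n : ℕ, q ^ (n * (n + 1))

/-- The Euler product `∏ (1 - w ^ (n + 1))`. -/
noncomputable def eulerProd (w : ℂ) : ℂ := ∏' n : ℕ, (1 - w ^ (n + 1))

theorem analyticAt_thetaSeries : AnalyticAt ℂ thetaSeries 0 := by
  have := (analyticAt_tsum_pow (e := fun n => (n + 1) ^ 2) fun n => by nlinarith).1
  unfold thetaSeries
  fun_prop

theorem analyticAt_thetaSeries₂ : AnalyticAt ℂ thetaSeries₂ 0 := by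
  have := (analyticAt_tsum_pow (e := fun n => n * (n + 1)) fun n => by nlinarith).1
  unfold thetaSeries₂
  fun_prop

theorem analyticAt_eulerProd : AnalyticAt ℂ eulerProd 0 :=
  ModularForm.differentiableOn_tprod_one_sub_pow.analyticAt
    (Metric.ball_mem_nhds 0 one_pos)

theorem congrMod_thetaSeries : CongrMod 4 thetaSeries fun q => 1 + 2 * q := by
  obtain ⟨h1, h2⟩ := analyticAt_tsum_pow (e := fun n => (n + 2) ^ 2 - 4) fun n => by
    have : (n + 2) ^ 2 = n * n + 4 * n + 4 := by ring
    simp only [this, Nat.add_sub_cancel]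
    nlinarith
  refine ⟨by fun_prop, fun q => 2 * ∑' n : ℕ, q ^ ((n + 2) ^ 2 - 4), by fun_prop, ?_⟩
  filter_upwards [Metric.ball_mem_nhds (0 : ℂ) one_pos] with q hq
  have hq : ‖q‖ < 1 := by simpa using hq
  have hs := (analyticAt_tsum_pow (e := fun n => (n + 1) ^ 2) fun n => by nlinarith).2 q hq
  rw [thetaSeries, hs.tsum_eq_zero_add, mul_left_comm (q ^ 4), ← tsum_mul_left (a := q ^ 4)]
  have : ∀ n : ℕ, q ^ 4 * q ^ ((n + 2) ^ 2 - 4) = q ^ ((n + 1 + 1) ^ 2) := fun n => by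
    rw [← pow_add]
    congr 1
    have : (n + 2) ^ 2 = n * n + 4 * n + 4 := by ring
    rw [show n + 1 + 1 = n + 2 by ring]
    omega
  simp only [this]
  ring

/-- The linear coefficient of the Euler product, by logarithmic differentiation. -/
theorem deriv_eulerProd_zero : deriv eulerProd 0 = -1 := by
  have h0 : ∀ n : ℕ, logDeriv (fun w : ℂ => 1 - w ^ (n + 1)) 0 = if n = 0 then -1 else 0 :=
    fun n => by
      rw [logDeriv_apply]
      rcases n with _ | n
      · simp
      · simp
  have hp : eulerProd 0 = 1 := by simp [eulerProd]
  have := logDeriv_tprod_eq_tsum (f := fun n (w : ℂ) => 1 - w ^ (n + 1)) Metric.isOpen_ball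
    (Metric.mem_ball_self (x := (0 : ℂ)) one_pos) (by simp) (fun n => by fun_prop)
    (by simp only [h0]; exact (hasSum_ite_eq 0 (-1 : ℂ)).summable)
    ModularForm.multipliableLocallyUniformlyOn_one_sub_pow (by simp)
  simp only [h0, tsum_ite_eq] at this
  change logDeriv eulerProd 0 = -1 at this
  rwa [logDeriv_apply, hp, div_one] at this

theorem congrMod_eulerProd : CongrMod 2 eulerProd fun w => 1 - w := by
  have hd := ModularForm.differentiableOn_tprod_one_sub_pow
  have hb := Metric.ball_mem_nhds (0 : ℂ) one_pos
  have h1 := (Complex.differentiableOn_dslope hb).mpr hd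
  have h2 := (Complex.differentiableOn_dslope hb).mpr h1
  have hp : eulerProd 0 = 1 := by simp [eulerProd]
  refine ⟨by fun_prop, _, h2.analyticAt hb, Eventually.of_forall fun w => ?_⟩
  change eulerProd w = 1 - w + w ^ 2 * dslope (dslope eulerProd 0) 0 w
  rcases eq_or_ne w 0 with rfl | hw
  · simp [hp]
  · rw [dslope_of_ne _ hw, slope_def_field, dslope_of_ne _ hw, dslope_same, slope_def_field,
      deriv_eulerProd_zero, hp]
    field_simp
    ring

theorem CongrMod.comp_pow {k l m : ℕ} {F G : ℂ → ℂ} (h : CongrMod k F G) (hm : m ≠ 0)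
    (hl : l ≤ m * k) : CongrMod l (fun q => F (q ^ m)) fun q => G (q ^ m) := by
  obtain ⟨hG, r, hr, e⟩ := h
  have h0 : (0 : ℂ) ^ m = 0 := zero_pow hm
  have hp : AnalyticAt ℂ (fun q : ℂ => q ^ m) 0 := by fun_prop
  refine ⟨AnalyticAt.fun_comp (by rwa [h0]) hp, fun q => q ^ (m * k - l) * r (q ^ m), ?_, ?_⟩
  · have : AnalyticAt ℂ (fun q : ℂ => r (q ^ m)) 0 := AnalyticAt.fun_comp (by rwa [h0]) hp
    exact (by fun_prop : AnalyticAt ℂ (fun q : ℂ => q ^ (m * k - l)) 0).mul this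
  · have ht : Tendsto (fun q : ℂ => q ^ m) (𝓝 0) (𝓝 0) := by
      simpa [h0] using hp.continuousAt.tendsto
    filter_upwards [ht.eventually e] with q hq
    rw [hq, ← mul_assoc, ← pow_add, ← pow_mul, Nat.add_sub_cancel' hl]

/-- The expansion in `q` of `θ₃(t)² θ₃(5t)²`. -/
noncomputable def ZSeries (q : ℂ) : ℂ := (thetaSeries q * thetaSeries (q ^ 5)) ^ 2

/-- The expansion in `q` of `η(t)² η(5t)² / q`. -/
noncomputable def uSeries (q : ℂ) : ℂ := (eulerProd (q ^ 2) * eulerProd (q ^ 10)) ^ 2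

/-- The expansion in `q` of `θ₂(t)² θ₂(5t)² / q ^ 3`. -/
noncomputable def bSeries (q : ℂ) : ℂ := (thetaSeries₂ q * thetaSeries₂ (q ^ 5)) ^ 2

/-- The expansion in `q` of `η(t)² η(5t)²`. -/
noncomputable def zSeries (q : ℂ) : ℂ := q * uSeries q

theorem analyticAt_comp_pow {F : ℂ → ℂ} (hF : AnalyticAt ℂ F 0) {m : ℕ} (hm : m ≠ 0) :
    AnalyticAt ℂ (fun q => F (q ^ m)) 0 :=
  AnalyticAt.fun_comp (by rwa [zero_pow hm]) (by fun_prop : AnalyticAt ℂ (fun q : ℂ => q ^ m) 0)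

theorem analyticAt_ZSeries : AnalyticAt ℂ ZSeries 0 :=
  (analyticAt_thetaSeries.mul (analyticAt_comp_pow analyticAt_thetaSeries (by norm_num))).pow 2

theorem analyticAt_uSeries : AnalyticAt ℂ uSeries 0 :=
  ((analyticAt_comp_pow analyticAt_eulerProd (by norm_num)).mul
    (analyticAt_comp_pow analyticAt_eulerProd (by norm_num))).pow 2

theorem analyticAt_bSeries : AnalyticAt ℂ bSeries 0 :=
  (analyticAt_thetaSeries₂.mul (analyticAt_comp_pow analyticAt_thetaSeries₂ (by norm_num))).pow 2

theorem analyticAt_zSeries : AnalyticAt ℂ zSeries 0 := analyticAt_id.mul analyticAt_uSeries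

theorem cuspParam_pow (t : ℂ) (n : ℕ) : cuspParam t ^ n = cexp (Real.pi * I * n * t) := by
  rw [cuspParam, ← Complex.exp_nat_mul]
  congr 1
  ring

theorem cuspParam_five_mul (t : ℂ) : cuspParam (5 * t) = cuspParam t ^ 5 := by
  rw [cuspParam_pow, cuspParam]
  congr 1
  push_cast
  ring

theorem jacobiTheta_eq_thetaSeries {t : ℂ} (ht : 0 < t.im) :
    jacobiTheta t = thetaSeries (cuspParam t) := by
  have h := (hasSum_nat_jacobiTheta ht).tsum_eq
  have e : ∀ n : ℕ, cexp (Real.pi * I * ((n : ℂ) + 1) ^ 2 * t) = cuspParam t ^ ((n + 1) ^ 2) :=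
    fun n => by rw [cuspParam_pow]; push_cast; rfl
  simp only [e] at h
  rw [thetaSeries, h]
  ring

theorem jacobiTheta₂_half_eq_thetaSeries₂ {t : ℂ} (ht : 0 < t.im) :
    jacobiTheta₂ (t / 2) t = thetaSeries₂ (cuspParam t) := by
  have h := (hasSum_jacobiTheta₂_term (t / 2) ht).nat_add_neg_add_one
  have e : ∀ n : ℕ, jacobiTheta₂_term n (t / 2) t + jacobiTheta₂_term (-(n + 1)) (t / 2) t =
      2 * cuspParam t ^ (n * (n + 1)) := fun n => by
    rw [jacobiTheta₂_term, jacobiTheta₂_term, two_mul (cuspParam t ^ _), cuspParam_pow]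
    congr 1 <;>
    · congr 1
      push_cast
      ring
  simp only [e] at h
  rw [thetaSeries₂, ← tsum_mul_left, h.tsum_eq]

theorem prodFive_thetaSq₃_eq {t : ℂ} (ht : 0 < t.im) :
    prodFive thetaSq₃ t = ZSeries (cuspParam t) := by
  rw [prodFive, thetaSq₃, thetaSq₃, jacobiTheta_eq_thetaSeries ht,
    jacobiTheta_eq_thetaSeries (by simpa using ht), cuspParam_five_mul, ZSeries, mul_pow]

theorem prodFive_thetaSq₂_eq {t : ℂ} (ht : 0 < t.im) :
    prodFive thetaSq₂ t = cuspParam t ^ 3 * bSeries (cuspParam t) := by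
  rw [prodFive, thetaSq₂, thetaSq₂, jacobiTheta₂_half_eq_thetaSeries₂ ht,
    jacobiTheta₂_half_eq_thetaSeries₂ (by simpa using ht), cuspParam_five_mul, bSeries, mul_pow,
    mul_pow, mul_pow, mul_mul_mul_comm]
  congr 1
  rw [cuspParam_pow, ← Complex.exp_nat_mul, ← Complex.exp_nat_mul, ← Complex.exp_add]
  congr 1
  push_cast
  ring

theorem eta_eq_eulerProd (t : ℂ) :
    ModularForm.eta t = cexp (Real.pi * I * t / 12) * eulerProd (cuspParam t ^ 2) := by
  rw [ModularForm.eta, eulerProd, Function.Periodic.qParam]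
  congr 1
  · congr 1
    push_cast
    ring
  · refine tprod_congr fun n => ?_
    rw [ModularForm.eta_q_eq_pow, cuspParam_pow]
    congr 3
    push_cast
    ring

theorem etaProd_eq (t : ℂ) : etaProd t = zSeries (cuspParam t) := by
  rw [etaProd, prodFive, eta_eq_eulerProd, eta_eq_eulerProd, cuspParam_five_mul, zSeries, uSeries,
    ← pow_mul, mul_pow, mul_pow, mul_pow, mul_mul_mul_comm]
  congr 1
  rw [cuspParam, ← Complex.exp_nat_mul, ← Complex.exp_nat_mul, ← Complex.exp_add]
  congr 1
  push_cast
  ring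

theorem congrMod_ZSeries : CongrMod 4 ZSeries fun q => 1 + 4 * q + 4 * q ^ 2 := by
  have h5 : CongrMod 4 (fun q => thetaSeries (q ^ 5)) fun _ => 1 := by
    refine CongrMod.trans_poly (P := fun q => 2 * q) ?_ (by fun_prop) (by fun_prop)
    convert congrMod_thetaSeries.comp_pow (m := 5) (l := 4) (by norm_num) (by norm_num) using 2
    ring
  convert (congrMod_thetaSeries.mul h5).pow 2 using 2
  · rfl
  · ring

theorem congrMod_uSeries : CongrMod 4 uSeries fun q => 1 + 0 * q + (-2) * q ^ 2 := by
  have h2 := congrMod_eulerProd.comp_pow (m := 2) (l := 4) (by norm_num) (by norm_num)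
  have h10 : CongrMod 4 (fun q => eulerProd (q ^ 10)) fun _ => 1 := by
    refine CongrMod.trans_poly (P := fun q => -q ^ 6) ?_ (by fun_prop) (by fun_prop)
    convert congrMod_eulerProd.comp_pow (m := 10) (l := 4) (by norm_num) (by norm_num) using 2
    ring
  refine CongrMod.trans_poly (P := fun q => 1) ?_ (by fun_prop) (by fun_prop)
  convert (h2.mul h10).pow 2 using 2
  · rfl
  · ring

theorem euler_quadratic (a b c : ℂ) :
    euler (fun q => a + b * q + c * q ^ 2) = fun q => 0 + b * q + 2 * c * q ^ 2 := by
  funext q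
  have := (((hasDerivAt_id q).const_mul b).const_add a).add (((hasDerivAt_id q).pow 2).const_mul c)
  rw [euler, HasDerivAt.deriv (f := fun q => a + b * q + c * q ^ 2) this]
  simp only [id]
  push_cast
  ring

/-- The numerator of `firstForm` is `q ^ 2` times the left side, where `z = q u`; the lemma says that it
is divisible by `q ^ 6`, the order of `z ^ 6`. The witness comes from inserting the truncations
`1 + 4 q + 4 q²` and `1 - 2 q²` for `ZSeries` and `uSeries`. -/
theorem exists_first_eq_pow_four_mul : ∃ r, AnalyticAt ℂ r 0 ∧ ∀ᶠ q in 𝓝 0,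
    (ZSeries q * (uSeries q + euler uSeries q) - uSeries q * euler ZSeries q) ^ 2 -
      uSeries q ^ 2 * ZSeries q * (ZSeries q - 4 * (q * uSeries q)) *
        (ZSeries q ^ 2 - 12 * (q * uSeries q) * ZSeries q + 16 * (q * uSeries q) ^ 2) =
      q ^ 4 * r q := by
  have hZ := congrMod_ZSeries
  have hu := congrMod_uSeries
  have hZ1 := hZ.euler
  have hu1 := hu.euler
  have hq : CongrMod 4 (fun q : ℂ => q) fun q => q := CongrMod.refl analyticAt_id
  rw [euler_quadratic] at hZ1 hu1
  have hqu := hq.mul hu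
  have key := (((hZ.mul (hu.add hu1)).sub (hu.mul hZ1)).pow 2).sub
    ((((hu.pow 2).mul hZ).mul (hZ.sub (hqu.const_mul 4))).mul
      (((hZ.pow 2).sub ((hqu.const_mul 12).mul hZ)).add ((hqu.pow 2).const_mul 16)))
  refine CongrMod.exists_eq_mul (P := fun q => (48) * q ^ 0 + (192) * q ^ 1 + (-160) * q ^ 2 + (-1920) * q ^ 3 + (-3136) * q ^ 4 + (1536) * q ^ 5 + (13312) * q ^ 6 + (19456) * q ^ 7 + (3072) * q ^ 8 + (-22528) * q ^ 9 + (-24576) * q ^ 10 + (-8192) * q ^ 11) ?_ (by fun_prop)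
  convert key using 2
  ring

/-- The numerator of `secondForm` is divisible by `q ^ 4`, the order of `z ^ 4`; the witness is found as
in the case of `firstForm`. -/
theorem exists_second_eq_pow_four_mul : ∃ r, AnalyticAt ℂ r 0 ∧ ∀ᶠ q in 𝓝 0,
    2 * ZSeries q * euler (euler ZSeries) q - 3 * euler ZSeries q ^ 2 -
      8 * ZSeries q * (q * uSeries q) * (ZSeries q ^ 2 - 10 * ZSeries q * (q * uSeries q) +
        18 * (q * uSeries q) ^ 2) = q ^ 4 * r q := by
  have hZ := congrMod_ZSeries
  have hu := congrMod_uSeries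
  have hZ1 := hZ.euler
  have hZ2 := hZ1.euler
  have hq : CongrMod 4 (fun q : ℂ => q) fun q => q := CongrMod.refl analyticAt_id
  rw [euler_quadratic] at hZ1 hZ2
  rw [euler_quadratic] at hZ2
  have hqu := hq.mul hu
  have key := (((hZ.const_mul 2).mul hZ2).sub ((hZ1.pow 2).const_mul 3)).sub
    ((((hZ.const_mul 8).mul hqu)).mul
      (((hZ.pow 2).sub ((hZ.const_mul 10).mul hqu)).add ((hqu.pow 2).const_mul 18)))
  refine CongrMod.exists_eq_mul (P := fun q => (-128) * q ^ 0 + (-672) * q ^ 1 + (-1600) * q ^ 2 + (-2624) * q ^ 3 + (-1280) * q ^ 4 + (5504) * q ^ 5 + (9728) * q ^ 6 + (4608) * q ^ 7) ?_ (by fun_prop)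
  convert key using 2
  ring

/-- `firstForm` in terms of expansions. The equation `q = cuspParam t` is kept as a hypothesis so that
the formula can be stated in the variable `q`. -/
theorem firstForm_eq_of_expansion {Z z Zs zs : ℂ → ℂ} (hZs : AnalyticAt ℂ Zs 0)
    (hzs : AnalyticAt ℂ zs 0) (hZ : ∀ᶠ t in atCusp, Z t = Zs (cuspParam t))
    (hz : ∀ᶠ t in atCusp, z t = zs (cuspParam t)) :
    ∀ᶠ t in atCusp, ∀ q, q = cuspParam t → firstForm Z z t =
      ((Zs q * euler zs q - zs q * euler Zs q) ^ 2 -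
        zs q ^ 2 * Zs q * (Zs q - 4 * zs q) * (Zs q ^ 2 - 12 * zs q * Zs q + 16 * zs q ^ 2)) /
          zs q ^ 6 := by
  filter_upwards [hZ, hz, deriv_eq_euler hZs 1 (by simpa using hZ),
    deriv_eq_euler hzs 1 (by simpa using hz)] with t h1 h2 h3 h4
  rintro _ rfl
  have hπ : (Real.pi * I : ℂ) ≠ 0 := by simp [Real.pi_ne_zero]
  rw [firstForm, h1, h2, h3, h4]
  congr 2
  field_simp

theorem secondForm_eq_of_expansion {Z z Zs zs : ℂ → ℂ} (hZs : AnalyticAt ℂ Zs 0)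
    (hZ : ∀ᶠ t in atCusp, Z t = Zs (cuspParam t))
    (hz : ∀ᶠ t in atCusp, z t = zs (cuspParam t)) :
    ∀ᶠ t in atCusp, ∀ q, q = cuspParam t → secondForm Z z t =
      (2 * Zs q * euler (euler Zs) q - 3 * euler Zs q ^ 2 -
        8 * Zs q * zs q * (Zs q ^ 2 - 10 * Zs q * zs q + 18 * zs q ^ 2)) / zs q ^ 4 := by
  have h := deriv_eq_euler hZs 1 (by simpa using hZ)
  filter_upwards [hZ, hz, h, deriv_eq_euler hZs.euler _ h] with t h1 h2 h3 h4
  rintro _ rfl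
  have hπ : (Real.pi * I : ℂ) ≠ 0 := by simp [Real.pi_ne_zero]
  rw [secondForm, h1, h2, h3, h4]
  congr 2
  field_simp

theorem uSeries_zero : uSeries 0 = 1 := by simp [uSeries, eulerProd]

theorem ZSeries_zero : ZSeries 0 = 1 := by simp [ZSeries, thetaSeries]

theorem euler_id_mul {F : ℂ → ℂ} {q : ℂ} (hF : AnalyticAt ℂ F q) :
    euler (fun q => q * F q) q = q * (F q + euler F q) := by
  have := (hasDerivAt_id q).mul hF.differentiableAt.hasDerivAt
  rw [euler, HasDerivAt.deriv (f := fun q => q * F q) this, euler]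
  simp only [id]
  ring

theorem eventually_prodFive_thetaSq₃_eq :
    ∀ᶠ t in atCusp, prodFive thetaSq₃ t = ZSeries (cuspParam t) :=
  eventually_im_pos.mono fun _ => prodFive_thetaSq₃_eq

/-- Boundedness at `i∞` for `θ₃`. -/
theorem isBigO_forms_one :
    firstForm (prodFive thetaSq₃) etaProd =O[atCusp] (fun _ => (1 : ℂ)) ∧
      secondForm (prodFive thetaSq₃) etaProd =O[atCusp] (fun _ => (1 : ℂ)) := by
  have hu := analyticAt_uSeries
  have hu0 : ∀ n, uSeries 0 ^ n ≠ 0 := by simp [uSeries_zero]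
  constructor
  · obtain ⟨r, hr, he⟩ := exists_first_eq_pow_four_mul
    have hlim : Tendsto (fun t => r (cuspParam t) / uSeries (cuspParam t) ^ 6) atCusp
        (𝓝 (r 0 / uSeries 0 ^ 6)) :=
      (hr.continuousAt.div (hu.continuousAt.pow 6) (hu0 6)).tendsto.comp tendsto_cuspParam
    refine (hlim.congr' ?_).isBigO_one ℂ
    filter_upwards [firstForm_eq_of_expansion analyticAt_ZSeries analyticAt_zSeries
      eventually_prodFive_thetaSq₃_eq (Eventually.of_forall etaProd_eq),
      tendsto_cuspParam.eventually he, tendsto_cuspParam.eventually hu.eventually_analyticAt]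
      with t h1 h2 h3
    rw [h1 _ rfl]
    have hq := cuspParam_ne_zero t
    generalize cuspParam t = q at *
    rw [show euler zSeries q = _ from euler_id_mul h3]
    simp only [zSeries]
    rw [mul_pow q (uSeries q) 6, ← mul_div_mul_left (r q) _ (pow_ne_zero 6 hq)]
    congr 1
    linear_combination -q ^ 2 * h2
  · obtain ⟨r, hr, he⟩ := exists_second_eq_pow_four_mul
    have hlim : Tendsto (fun t => r (cuspParam t) / uSeries (cuspParam t) ^ 4) atCusp
        (𝓝 (r 0 / uSeries 0 ^ 4)) :=
      (hr.continuousAt.div (hu.continuousAt.pow 4) (hu0 4)).tendsto.comp tendsto_cuspParam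
    refine (hlim.congr' ?_).isBigO_one ℂ
    filter_upwards [secondForm_eq_of_expansion analyticAt_ZSeries
      eventually_prodFive_thetaSq₃_eq (Eventually.of_forall etaProd_eq),
      tendsto_cuspParam.eventually he] with t h1 h2
    rw [h1 _ rfl]
    have hq := cuspParam_ne_zero t
    generalize cuspParam t = q at *
    simp only [zSeries]
    rw [mul_pow q (uSeries q) 4, ← mul_div_mul_left (r q) _ (pow_ne_zero 4 hq), h2]

/-- Vanishing at `i∞` for `θ₂`. Here `Z` vanishes to order three and `z` to order one, which makes all
terms of the numerators vanish to order at least eight, respectively six, while the denominators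
have the orders six and four. -/
theorem tendsto_forms_zero :
    Tendsto (firstForm (prodFive thetaSq₂) (-etaProd)) atCusp (𝓝 0) ∧
      Tendsto (secondForm (prodFive thetaSq₂) (-etaProd)) atCusp (𝓝 0) := by
  have hu := analyticAt_uSeries
  have hu1 := hu.euler
  have hb := analyticAt_bSeries
  have hb1 := hb.euler
  have hb2 := hb1.euler
  have hu0 : ∀ n, uSeries 0 ^ n ≠ 0 := by simp [uSeries_zero]
  -- `θ₂(t)² θ₂(5t)²` is `q * (q * (q * b))`, so that the product rule applies three times
  obtain ⟨B, hB⟩ : ∃ B : ℂ → ℂ, B = fun q => q * (q * (q * bSeries q)) := ⟨_, rfl⟩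
  have hBan : AnalyticAt ℂ B 0 := by rw [hB]; fun_prop
  obtain ⟨zs, hzdef⟩ : ∃ zs : ℂ → ℂ, zs = fun q => q * -uSeries q := ⟨_, rfl⟩
  have hzan : AnalyticAt ℂ zs 0 := by rw [hzdef]; fun_prop
  have hZB : ∀ᶠ t in atCusp, prodFive thetaSq₂ t = B (cuspParam t) :=
    eventually_im_pos.mono fun t ht => by rw [prodFive_thetaSq₂_eq ht, hB]; ring
  have hzs : ∀ᶠ t in atCusp, (-etaProd) t = zs (cuspParam t) :=
    Eventually.of_forall fun t => by rw [Pi.neg_apply, etaProd_eq, zSeries, hzdef]; ring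
  have hB1 : ∀ q, AnalyticAt ℂ bSeries q → euler B q = q ^ 3 * (3 * bSeries q + euler bSeries q) :=
    fun q h => by
      rw [hB, euler_id_mul (by fun_prop), euler_id_mul (by fun_prop), euler_id_mul h]; ring
  have hB2 : ∀ᶠ q in 𝓝 0, euler (euler B) q =
      q ^ 3 * (9 * bSeries q + 6 * euler bSeries q + euler (euler bSeries) q) := by
    filter_upwards [hb.eventually_analyticAt.eventually_nhds] with q hq
    have hbq := hq.self_of_nhds
    have e : euler B =ᶠ[𝓝 q]
        fun q => q * (q * (q * (3 * bSeries q + euler bSeries q))) := by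
      filter_upwards [hq] with s hs
      rw [hB1 s hs]; ring
    have hbq1 := hbq.euler
    have hlin : euler (fun q => 3 * bSeries q + euler bSeries q) q =
        3 * euler bSeries q + euler (euler bSeries) q := by
      have := (hbq.differentiableAt.hasDerivAt.const_mul 3).add hbq1.differentiableAt.hasDerivAt
      rw [euler, HasDerivAt.deriv (f := fun q => 3 * bSeries q + euler bSeries q) this]
      simp only [euler]
      ring
    rw [euler, e.deriv_eq]
    change euler (fun q => q * (q * (q * (3 * bSeries q + euler bSeries q)))) q = _
    rw [euler_id_mul (by fun_prop), euler_id_mul (by fun_prop), euler_id_mul (by fun_prop), hlin]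
    ring
  constructor
  · obtain ⟨R, hR⟩ : ∃ R : ℂ → ℂ, R = fun q => q ^ 2 * ((bSeries q * (uSeries q + euler uSeries q) -
        uSeries q * (3 * bSeries q + euler bSeries q)) ^ 2 - uSeries q ^ 2 * bSeries q *
        (q ^ 2 * bSeries q + 4 * uSeries q) * (q ^ 4 * bSeries q ^ 2 +
        12 * q ^ 2 * uSeries q * bSeries q + 16 * uSeries q ^ 2)) / uSeries q ^ 6 :=
      ⟨_, rfl⟩
    have hRan : AnalyticAt ℂ R 0 := by
      rw [hR]
      exact AnalyticAt.fun_div (by fun_prop) (hu.pow 6) (hu0 6)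
    have hlim : Tendsto (fun t => R (cuspParam t)) atCusp (𝓝 0) := by
      have := hRan.continuousAt.tendsto.comp tendsto_cuspParam
      rwa [show R 0 = 0 by simp [hR]] at this
    refine hlim.congr' ?_
    filter_upwards [firstForm_eq_of_expansion hBan hzan hZB hzs,
      tendsto_cuspParam.eventually hu.eventually_analyticAt,
      tendsto_cuspParam.eventually hb.eventually_analyticAt] with t h1 h2 h3
    rw [h1 _ rfl]
    have hq := cuspParam_ne_zero t
    generalize cuspParam t = q at *
    have hneg : euler (fun q => -uSeries q) q = -euler uSeries q := by
      rw [euler, euler, HasDerivAt.deriv (f := fun q => -uSeries q)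
        h2.differentiableAt.hasDerivAt.neg]
      ring
    simp only [hR, hzdef]
    rw [euler_id_mul (F := fun q => -uSeries q) h2.neg, hneg, hB1 q h3, hB]
    rw [show (q * -uSeries q) ^ 6 = q ^ 6 * uSeries q ^ 6 by ring,
      ← mul_div_mul_left _ (uSeries q ^ 6) (pow_ne_zero 6 hq)]
    congr 1
    ring
  · obtain ⟨R, hR⟩ : ∃ R : ℂ → ℂ, R = fun q => q ^ 2 * (2 * bSeries q * (9 * bSeries q +
        6 * euler bSeries q + euler (euler bSeries) q) - 3 * (3 * bSeries q + euler bSeries q) ^ 2 +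
        8 * bSeries q * uSeries q * (q ^ 4 * bSeries q ^ 2 + 10 * q ^ 2 * bSeries q * uSeries q +
        18 * uSeries q ^ 2)) / uSeries q ^ 4 :=
      ⟨_, rfl⟩
    have hRan : AnalyticAt ℂ R 0 := by
      rw [hR]
      exact AnalyticAt.fun_div (by fun_prop) (hu.pow 4) (hu0 4)
    have hlim : Tendsto (fun t => R (cuspParam t)) atCusp (𝓝 0) := by
      have := hRan.continuousAt.tendsto.comp tendsto_cuspParam
      rwa [show R 0 = 0 by simp [hR]] at this
    refine hlim.congr' ?_
    filter_upwards [secondForm_eq_of_expansion hBan hZB hzs,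
      tendsto_cuspParam.eventually hB2,
      tendsto_cuspParam.eventually hb.eventually_analyticAt] with t h1 h2 h3
    rw [h1 _ rfl]
    have hq := cuspParam_ne_zero t
    generalize cuspParam t = q at *
    simp only [hR, hzdef]
    rw [h2, hB1 q h3, hB]
    rw [show (q * -uSeries q) ^ 4 = q ^ 4 * uSeries q ^ 4 by ring,
      ← mul_div_mul_left _ (uSeries q ^ 4) (pow_ne_zero 4 hq)]
    congr 1
    ring

/-- The local parameter maps every half-plane at `i∞` onto a punctured neighbourhood of the origin. -/
theorem eventually_eq_of_eventually_atCusp {F G : ℂ → ℂ} (hF : ContinuousAt F 0)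
    (hG : ContinuousAt G 0) (h : ∀ᶠ t in atCusp, F (cuspParam t) = G (cuspParam t)) :
    ∀ᶠ q in 𝓝 0, F q = G q := by
  have hne : ∀ᶠ q in 𝓝[≠] 0, F q = G q := by
    obtain ⟨U, hU, hp⟩ := (eventually_comap.mp h).exists_mem
    obtain ⟨C, hC⟩ := mem_atTop_sets.mp hU
    have hr : (0 : ℝ) < Real.exp (-Real.pi * C) := Real.exp_pos _
    filter_upwards [self_mem_nhdsWithin,
      nhdsWithin_le_nhds (Metric.ball_mem_nhds (0 : ℂ) hr)] with q hq hqr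
    have hq0 : q ≠ 0 := hq
    have hpi : (Real.pi * I : ℂ) ≠ 0 := by simp [Real.pi_ne_zero]
    have e : cuspParam (Complex.log q / (Real.pi * I)) = q := by
      rw [cuspParam, mul_div_cancel₀ _ hpi, Complex.exp_log hq0]
    have him : C ≤ (Complex.log q / (Real.pi * I)).im := by
      have h1 : ‖q‖ < Real.exp (-Real.pi * C) := by simpa using hqr
      rw [← e, norm_cuspParam, Real.exp_lt_exp] at h1
      nlinarith [Real.pi_pos]
    have := hp _ (hC _ him) _ rfl
    rwa [e] at this
  have h0 : F 0 = G 0 :=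
    tendsto_nhds_unique_of_eventuallyEq (hF.tendsto.mono_left nhdsWithin_le_nhds)
      (hG.tendsto.mono_left nhdsWithin_le_nhds) hne
  filter_upwards [eventually_nhdsWithin_iff.mp hne] with q hq
  rcases eq_or_ne q 0 with rfl | h
  · exact h0
  · exact hq h

/-- The two differential equations satisfied by the expansions of `Z` and `z` at the cusp. -/
theorem series_differential_equations : ∀ᶠ q in 𝓝 0,
    (ZSeries q * euler zSeries q - zSeries q * euler ZSeries q) ^ 2 =
        zSeries q ^ 2 * ZSeries q * (ZSeries q - 4 * zSeries q) *
          (ZSeries q ^ 2 - 12 * zSeries q * ZSeries q + 16 * zSeries q ^ 2) ∧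
      2 * ZSeries q * euler (euler ZSeries) q - 3 * euler ZSeries q ^ 2 =
        8 * ZSeries q * zSeries q *
          (ZSeries q ^ 2 - 10 * ZSeries q * zSeries q + 18 * zSeries q ^ 2) := by
  have hZ := analyticAt_ZSeries
  have hz := analyticAt_zSeries
  have hZ1 := hZ.euler
  have hz1 := hz.euler
  have hZ2 := hZ1.euler
  have hzne : ∀ t : ℂ, 0 < t.im → zSeries (cuspParam t) ≠ 0 := fun t ht => by
    rw [← etaProd_eq]; exact etaProd_ne_zero ht
  refine Eventually.and ?_ ?_
  · refine eventually_eq_of_eventually_atCusp (AnalyticAt.continuousAt (𝕜 := ℂ) (by fun_prop))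
      (AnalyticAt.continuousAt (𝕜 := ℂ) (by fun_prop)) ?_
    filter_upwards [firstForm_eq_of_expansion hZ hz
      eventually_prodFive_thetaSq₃_eq (Eventually.of_forall etaProd_eq), eventually_im_pos]
      with t h1 ht
    have := h1 _ rfl
    rw [firstForm_secondForm_permuted.1 isBigO_forms_one.1 tendsto_forms_zero.1 t ht, eq_comm,
      div_eq_zero_iff, or_iff_left (pow_ne_zero 6 (hzne t ht)), sub_eq_zero] at this
    exact this
  · refine eventually_eq_of_eventually_atCusp (AnalyticAt.continuousAt (𝕜 := ℂ) (by fun_prop))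
      (AnalyticAt.continuousAt (𝕜 := ℂ) (by fun_prop)) ?_
    filter_upwards [secondForm_eq_of_expansion hZ
      eventually_prodFive_thetaSq₃_eq (Eventually.of_forall etaProd_eq), eventually_im_pos]
      with t h1 ht
    have := h1 _ rfl
    rw [firstForm_secondForm_permuted.2 isBigO_forms_one.2 tendsto_forms_zero.2 t ht, eq_comm,
      div_eq_zero_iff, or_iff_left (pow_ne_zero 4 (hzne t ht)), sub_eq_zero] at this
    exact this

/-! ### Growth of the coefficients and the power series -/

/-- The sequence `c` grows at most like `ρ ^ n` for every `ρ > L`. -/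
def GrowthLE (c : ℕ → ℂ) (L : ℝ) : Prop := ∀ ρ, L < ρ → ∃ C, ∀ n, ‖c n‖ ≤ C * ρ ^ n

theorem GrowthLE.nat_mul {c : ℕ → ℂ} {L : ℝ} (hL : 0 < L) (hc : GrowthLE c L) :
    GrowthLE (fun n => n * c n) L := by
  intro ρ hρ
  obtain ⟨C, hC⟩ := hc ((L + ρ) / 2) (by linarith)
  have hρ0 : 0 < ρ := hL.trans hρ
  have hr : (L + ρ) / 2 / ρ < 1 := by rw [div_lt_one hρ0]; linarith
  have hr0 : 0 ≤ (L + ρ) / 2 / ρ := by positivity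
  obtain ⟨B, hB⟩ := (tendsto_self_mul_const_pow_of_lt_one hr0 hr).bddAbove_range
  have hC0 : 0 ≤ C := by simpa using (norm_nonneg _).trans (hC 0)
  refine ⟨C * B, fun n => ?_⟩
  have h1 : (n : ℝ) * ((L + ρ) / 2 / ρ) ^ n ≤ B := hB ⟨n, rfl⟩
  rw [div_pow, mul_div_assoc', div_le_iff₀ (by positivity)] at h1
  rw [norm_mul, Complex.norm_natCast]
  calc (n : ℝ) * ‖c n‖ ≤ n * (C * ((L + ρ) / 2) ^ n) := by gcongr; exact hC n
    _ = C * (n * ((L + ρ) / 2) ^ n) := by ring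
    _ ≤ C * (B * ρ ^ n) := by gcongr
    _ = C * B * ρ ^ n := by ring

theorem GrowthLE.summable {c : ℕ → ℂ} {L : ℝ} (hL : 0 < L) (hc : GrowthLE c L) {x : ℝ}
    (hx0 : 0 ≤ x) (hx : x < 1 / L) : Summable fun n => ‖c n‖ * x ^ n := by
  obtain ⟨ρ, hρ, hρx⟩ : ∃ ρ, L < ρ ∧ ρ * x < 1 := by
    rcases hx0.eq_or_lt with rfl | hx0
    · exact ⟨L + 1, by linarith, by simp⟩
    · have : L < 1 / x := by rwa [lt_one_div hL hx0]
      obtain ⟨ρ, h1, h2⟩ := exists_between this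
      exact ⟨ρ, h1, by rwa [lt_div_iff₀ hx0] at h2⟩
  obtain ⟨C, hC⟩ := hc ρ hρ
  refine Summable.of_nonneg_of_le (fun n => by positivity) (fun n => ?_)
    ((summable_geometric_of_lt_one (mul_nonneg (hL.trans hρ).le hx0) hρx).mul_left C)
  calc ‖c n‖ * x ^ n ≤ C * ρ ^ n * x ^ n := by gcongr; exact hC n
    _ = C * (ρ * x) ^ n := by rw [mul_pow]; ring

/-- The sum of the power series with coefficients `c`. -/
noncomputable def powerSum (c : ℕ → ℂ) (x : ℂ) : ℂ := ∑' n, c n * x ^ n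

theorem GrowthLE.hasSum {c : ℕ → ℂ} {L : ℝ} (hL : 0 < L) (hc : GrowthLE c L) {x : ℂ}
    (hx : ‖x‖ < 1 / L) : HasSum (fun n => c n * x ^ n) (powerSum c x) := by
  refine Summable.hasSum (Summable.of_norm ?_)
  simpa [norm_mul, norm_pow] using hc.summable hL (norm_nonneg x) hx

theorem GrowthLE.hasDerivAt {c : ℕ → ℂ} {L : ℝ} (hL : 0 < L) (hc : GrowthLE c L) {x : ℂ}
    (hx : ‖x‖ < 1 / L) :
    HasDerivAt (powerSum c) (∑' n : ℕ, c n * (n * x ^ (n - 1))) x := by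
  obtain ⟨r, hxr, hr⟩ := exists_between hx
  have hr0 : 0 < r := (norm_nonneg x).trans_lt hxr
  refine hasDerivAt_tsum_of_isPreconnected (t := Metric.ball 0 r) (y₀ := 0)
    (u := fun n : ℕ => ‖(n : ℂ) * c n‖ * r ^ n * r⁻¹)
    (((hc.nat_mul hL).summable hL hr0.le hr).mul_right _) Metric.isOpen_ball
    (convex_ball _ _).isPreconnected (fun n y _ => (hasDerivAt_pow n y).const_mul (c n))
    (fun n y hy => ?_) (Metric.mem_ball_self hr0) ?_ (by simpa using hxr)
  · have hy : ‖y‖ < r := by simpa using hy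
    rcases n with _ | n
    · simp
    · rw [norm_mul, norm_mul, norm_mul, norm_pow, Nat.add_sub_cancel, pow_succ, mul_assoc,
        mul_assoc (r ^ n), mul_inv_cancel₀ hr0.ne', mul_one]
      calc ‖c (n + 1)‖ * (‖((n + 1 : ℕ) : ℂ)‖ * ‖y‖ ^ n)
          ≤ ‖c (n + 1)‖ * (‖((n + 1 : ℕ) : ℂ)‖ * r ^ n) := by gcongr
        _ = _ := by ring
  · exact (hc.hasSum hL (by simpa using hL)).summable

theorem GrowthLE.euler_powerSum {c : ℕ → ℂ} {L : ℝ} (hL : 0 < L) (hc : GrowthLE c L) {x : ℂ}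
    (hx : ‖x‖ < 1 / L) : euler (powerSum c) x = powerSum (fun n => n * c n) x := by
  rw [euler, (hc.hasDerivAt hL hx).deriv, powerSum, ← tsum_mul_left]
  refine tsum_congr fun n => ?_
  rcases n with _ | n
  · simp
  · rw [Nat.add_sub_cancel, pow_succ]; ring

theorem GrowthLE.analyticAt {c : ℕ → ℂ} {L : ℝ} (hL : 0 < L) (hc : GrowthLE c L) {x : ℂ}
    (hx : ‖x‖ < 1 / L) : AnalyticAt ℂ (powerSum c) x := by
  have : DifferentiableOn ℂ (powerSum c) (Metric.ball 0 (1 / L)) := fun y hy =>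
    (hc.hasDerivAt hL (by simpa using hy)).differentiableAt.differentiableWithinAt
  exact this.analyticAt (Metric.isOpen_ball.mem_nhds (by simpa using hx))

/-- The rational sequence defined by the four term recurrence. -/
def coeff : ℕ → ℚ
  | 0 => 1
  | 1 => 4
  | 2 => 20
  | n + 3 => (4 * (2 * ((n : ℚ) + 2) + 1) * (2 * ((n : ℚ) + 2) ^ 2 + 2 * ((n : ℚ) + 2) + 1) *
      coeff (n + 2) - 16 * ((n : ℚ) + 2) * (4 * ((n : ℚ) + 2) ^ 2 + 1) * coeff (n + 1) +
      8 * (2 * ((n : ℚ) + 2) - 1) ^ 3 * coeff n) / ((n : ℚ) + 3) ^ 3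

theorem coeff_add_three (n : ℕ) : ((n : ℚ) + 3) ^ 3 * coeff (n + 3) =
    4 * (2 * ((n : ℚ) + 2) + 1) * (2 * ((n : ℚ) + 2) ^ 2 + 2 * ((n : ℚ) + 2) + 1) *
      coeff (n + 2) - 16 * ((n : ℚ) + 2) * (4 * ((n : ℚ) + 2) ^ 2 + 1) * coeff (n + 1) +
      8 * (2 * ((n : ℚ) + 2) - 1) ^ 3 * coeff n := by
  rw [coeff, mul_div_cancel₀]
  positivity

theorem exists_le_mul_pow {Q : ℕ → ℝ} {ρ : ℝ} {N : ℕ} (hρ : 0 < ρ) (hQ : ∀ n, 0 ≤ Q n)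
    (h : ∀ n, N ≤ n → Q (n + 1) ≤ ρ * Q n) : ∃ C, ∀ n, Q n ≤ C * ρ ^ n := by
  refine ⟨∑ i ∈ Finset.range (N + 1), Q i / ρ ^ i, fun n => ?_⟩
  have small : ∀ n ≤ N, Q n ≤ (∑ i ∈ Finset.range (N + 1), Q i / ρ ^ i) * ρ ^ n := fun n hn => by
    rw [← div_le_iff₀ (by positivity)]
    exact Finset.single_le_sum (f := fun i => Q i / ρ ^ i)
      (fun i _ => div_nonneg (hQ i) (by positivity)) (by simp; omega)
  rcases le_total n N with hn | hn
  · exact small n hn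
  · induction n, hn using Nat.le_induction with
    | base => exact small N le_rfl
    | succ n hn ih =>
      calc Q (n + 1) ≤ ρ * Q n := h n hn
        _ ≤ ρ * ((∑ i ∈ Finset.range (N + 1), Q i / ρ ^ i) * ρ ^ n) := by gcongr
        _ = _ := by ring

/-- Deviation of the recurrence from the one with constant coefficients obtained in the limit. -/
theorem abs_recurrence_error_le (n : ℕ) (x y w v : ℝ)
    (h : ((n : ℝ) + 3) ^ 3 * v =
      4 * (2 * ((n : ℝ) + 2) + 1) * (2 * ((n : ℝ) + 2) ^ 2 + 2 * ((n : ℝ) + 2) + 1) * w -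
        16 * ((n : ℝ) + 2) * (4 * ((n : ℝ) + 2) ^ 2 + 1) * y +
        8 * (2 * ((n : ℝ) + 2) - 1) ^ 3 * x) :
    |v - 16 * w + 64 * y - 64 * x| ≤ 288 / ((n : ℝ) + 3) * (|w| + |y| + |x|) := by
  have hn : (0 : ℝ) ≤ n := Nat.cast_nonneg n
  obtain ⟨m, hm, hm3⟩ : ∃ m : ℝ, m = n + 3 ∧ 3 ≤ m := ⟨n + 3, rfl, by linarith⟩
  have hn' : (n : ℝ) = m - 3 := by rw [hm]; ring
  rw [hn'] at h
  rw [← hm]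
  have hm0 : 0 < m := by linarith
  have e : m ^ 3 * (v - 16 * w + 64 * y - 64 * x) =
      -(24 * m ^ 2 - 16 * m + 4) * w + (192 * m ^ 2 - 208 * m + 80) * y -
        (288 * m ^ 2 - 432 * m + 216) * x := by
    linear_combination h
  have b : |m ^ 3 * (v - 16 * w + 64 * y - 64 * x)| ≤ 288 * m ^ 2 * (|w| + |y| + |x|) := by
    rw [e]
    refine (abs_sub _ _).trans ?_
    refine (add_le_add_left (abs_add_le _ _) _).trans ?_
    rw [abs_mul, abs_mul, abs_mul, abs_neg, abs_of_nonneg (by nlinarith : 0 ≤ 24 * m ^ 2 - 16 * m + 4),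
      abs_of_nonneg (by nlinarith : 0 ≤ 192 * m ^ 2 - 208 * m + 80),
      abs_of_nonneg (by nlinarith : 0 ≤ 288 * m ^ 2 - 432 * m + 216)]
    have h1 : (24 * m ^ 2 - 16 * m + 4) * |w| ≤ 288 * m ^ 2 * |w| := by gcongr; nlinarith
    have h2 : (192 * m ^ 2 - 208 * m + 80) * |y| ≤ 288 * m ^ 2 * |y| := by gcongr; nlinarith
    have h3 : (288 * m ^ 2 - 432 * m + 216) * |x| ≤ 288 * m ^ 2 * |x| := by gcongr; nlinarith
    linarith
  rw [abs_mul, abs_of_pos (by positivity : 0 < m ^ 3)] at b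
  have : 288 / m * (|w| + |y| + |x|) = 288 * m ^ 2 * (|w| + |y| + |x|) / m ^ 3 := by
    field_simp
  rw [this, le_div_iff₀ (by positivity)]
  linarith

/-- The characteristic polynomial of the recurrence has the roots `4` and `6 ± 2 √5`, so the
coefficients grow at most like the powers of any number above the largest root. A weighted sum of
the components of three consecutive terms along the eigenvectors serves as a norm. -/
theorem growthLE_coeff : GrowthLE (fun n => (coeff n : ℂ)) (6 + 2 * Real.sqrt 5) := by
  intro ρ hρ
  have h5 : Real.sqrt 5 ^ 2 = 5 := Real.sq_sqrt (by norm_num)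
  have h5a : 2 < Real.sqrt 5 := by rw [Real.lt_sqrt] <;> norm_num
  have h5b : Real.sqrt 5 < 3 := by rw [Real.sqrt_lt'] <;> norm_num
  obtain ⟨μ, hμ⟩ : ∃ μ, μ = 6 - 2 * Real.sqrt 5 := ⟨_, rfl⟩
  obtain ⟨lam, hlam⟩ : ∃ lam, lam = 6 + 2 * Real.sqrt 5 := ⟨_, rfl⟩
  rw [← hlam] at hρ
  have hsum : lam + μ = 12 := by rw [hμ, hlam]; ring
  have hprod : lam * μ = 16 := by rw [hμ, hlam]; linear_combination -4 * h5
  have hμ0 : 0 ≤ μ := by rw [hμ]; linarith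
  have hμ2 : μ ≤ 2 := by rw [hμ]; linarith
  have hlam10 : 10 ≤ lam := by rw [hlam]; linarith
  obtain ⟨s, hs0, hs1, hsρ⟩ : ∃ s : ℝ, 0 < s ∧ s ≤ 1 ∧ lam + 2 * s ≤ ρ :=
    ⟨min 1 ((ρ - lam) / 2), lt_min one_pos (by linarith), min_le_left _ _, by
      linarith [min_le_right 1 ((ρ - lam) / 2)]⟩
  obtain ⟨a, ha⟩ : ∃ a : ℕ → ℝ, a = fun n => (coeff n : ℝ) := ⟨_, rfl⟩
  have hrec : ∀ n : ℕ, |a (n + 3) - 16 * a (n + 2) + 64 * a (n + 1) - 64 * a n| ≤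
      288 / ((n : ℝ) + 3) * (|a (n + 2)| + |a (n + 1)| + |a n|) := fun n => by
    refine abs_recurrence_error_le n _ _ _ _ ?_
    simp only [ha]
    exact_mod_cast coeff_add_three n
  obtain ⟨b, hb⟩ : ∃ b : ℕ → ℝ, b = fun n => a (n + 1) - 4 * a n := ⟨_, rfl⟩
  obtain ⟨c, hc⟩ : ∃ c : ℕ → ℝ, c = fun n => b (n + 1) - μ * b n := ⟨_, rfl⟩
  have ea : ∀ n, a (n + 1) = 4 * a n + b n := fun n => by rw [hb]; ring
  have eb : ∀ n, b (n + 1) = μ * b n + c n := fun n => by rw [hc]; ring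
  have ec : ∀ n, c (n + 1) =
      lam * c n + (a (n + 3) - 16 * a (n + 2) + 64 * a (n + 1) - 64 * a n) := fun n => by
    rw [hc, hb]
    linear_combination -(a (n + 1 + 1) - 4 * a (n + 1)) * hsum + (a (n + 1) - 4 * a n) * hprod
  obtain ⟨Q, hQ⟩ : ∃ Q : ℕ → ℝ, Q = fun n => |c n| + s * |b n| + s * |a n| := ⟨_, rfl⟩
  -- `s` times the sum of the absolute values of three consecutive terms is at most `29 * Q n`,
  -- so from `N` on the deviation from constant coefficients is at most `s * Q n`
  obtain ⟨N, hN⟩ := exists_nat_ge (288 * 29 / s ^ 2)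
  have hstep : ∀ n, N ≤ n → Q (n + 1) ≤ ρ * Q n := by
    intro n hn
    have hQa : s * |a n| ≤ Q n := by
      rw [hQ]; linarith [abs_nonneg (c n), mul_nonneg hs0.le (abs_nonneg (b n))]
    have hQb : s * |b n| ≤ Q n := by
      rw [hQ]; linarith [abs_nonneg (c n), mul_nonneg hs0.le (abs_nonneg (a n))]
    have hQc : s * |c n| ≤ Q n := by
      rw [hQ]
      nlinarith [abs_nonneg (c n), mul_nonneg hs0.le (abs_nonneg (a n)),
        mul_nonneg hs0.le (abs_nonneg (b n))]
    have hQ0 : 0 ≤ Q n := le_trans (by positivity) hQa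
    have a1 : |a (n + 1)| ≤ 4 * |a n| + |b n| := by
      rw [ea]; exact (abs_add_le _ _).trans (by rw [abs_mul]; norm_num)
    have b1 : |b (n + 1)| ≤ μ * |b n| + |c n| := by
      rw [eb]; exact (abs_add_le _ _).trans (by rw [abs_mul, abs_of_nonneg hμ0])
    have a2 : |a (n + 2)| ≤ 4 * |a (n + 1)| + |b (n + 1)| := by
      rw [ea (n + 1)]; exact (abs_add_le _ _).trans (by rw [abs_mul]; norm_num)
    have b1' : μ * |b n| ≤ 2 * |b n| := by gcongr
    have herr : |a (n + 3) - 16 * a (n + 2) + 64 * a (n + 1) - 64 * a n| ≤ s * Q n := by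
      refine (hrec n).trans ?_
      have h1 : s * (|a (n + 2)| + |a (n + 1)| + |a n|) ≤ 29 * Q n := by
        nlinarith [abs_nonneg (a n), abs_nonneg (b n), abs_nonneg (c n)]
      have hn3 : 288 * 29 / s ^ 2 ≤ (n : ℝ) + 3 := by
        have : (N : ℝ) ≤ n := by exact_mod_cast hn
        linarith
      rw [div_le_iff₀ (by positivity)] at hn3
      rw [div_mul_eq_mul_div, div_le_iff₀ (by positivity)]
      have h2 : s * (288 * (|a (n + 2)| + |a (n + 1)| + |a n|)) ≤
          s * (s * Q n * ((n : ℝ) + 3)) := by nlinarith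
      exact le_of_mul_le_mul_left h2 hs0
    have c1 : |c (n + 1)| ≤ lam * |c n| + s * Q n := by
      rw [ec]
      refine (abs_add_le _ _).trans ?_
      rw [abs_mul, abs_of_nonneg (by linarith : 0 ≤ lam)]
      linarith
    have h1 : Q (n + 1) ≤ (lam + s) * Q n + s * Q n := by
      have e1 : Q (n + 1) = |c (n + 1)| + s * |b (n + 1)| + s * |a (n + 1)| := by rw [hQ]
      have e2 : Q n = |c n| + s * |b n| + s * |a n| := by rw [hQ]
      have m1 := mul_le_mul_of_nonneg_left b1 hs0.le
      have m2 := mul_le_mul_of_nonneg_left a1 hs0.le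
      have m3 := mul_le_mul_of_nonneg_left b1' hs0.le
      have p1 : 0 ≤ (lam + s - 4) * (s * |a n|) :=
        mul_nonneg (by linarith) (mul_nonneg hs0.le (abs_nonneg _))
      have p2 : 0 ≤ (lam + s - 3) * (s * |b n|) :=
        mul_nonneg (by linarith) (mul_nonneg hs0.le (abs_nonneg _))
      have e3 : (lam + s) * Q n = (lam + s) * |c n| + (lam + s) * (s * |b n|) +
        (lam + s) * (s * |a n|) := by rw [e2]; ring
      linarith
    nlinarith
  obtain ⟨C, hC⟩ := exists_le_mul_pow (by linarith) (fun n => by rw [hQ]; positivity) hstep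
  refine ⟨C / s, fun n => ?_⟩
  have h1 : s * |a n| ≤ C * ρ ^ n := by
    refine le_trans ?_ (hC n)
    rw [hQ]; linarith [abs_nonneg (c n), mul_nonneg hs0.le (abs_nonneg (b n))]
  have h2 : ‖(coeff n : ℂ)‖ = |a n| := by
    rw [ha, show ((coeff n : ℚ) : ℂ) = ((coeff n : ℝ) : ℂ) by push_cast; rfl, Complex.norm_real,
      Real.norm_eq_abs]
  rw [h2, div_mul_eq_mul_div, le_div_iff₀ hs0]
  linarith

theorem three_sub_sqrt_five_div_eight : (3 - Real.sqrt 5) / 8 = 1 / (6 + 2 * Real.sqrt 5) := by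
  have h5 : Real.sqrt 5 ^ 2 = 5 := Real.sq_sqrt (by norm_num)
  rw [div_eq_div_iff (by norm_num) (by positivity)]
  linear_combination -2 * h5

theorem _root_.HasSum.congr_zero {f : ℕ → ℂ} {s : ℂ} (h : HasSum f s) (hf : ∀ n, f n = 0) :
    HasSum (fun _ : ℕ => (0 : ℂ)) s := by
  rwa [show f = fun _ => 0 from funext hf] at h

/-- The generating function of the coefficients. -/
noncomputable def genFun : ℂ → ℂ := powerSum fun n => (coeff n : ℂ)

/-- The recurrence as a differential equation for the generating function. -/
theorem genFun_differential_equation {x : ℂ} (hx : ‖x‖ < 1 / (6 + 2 * Real.sqrt 5)) :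
    (1 - 16 * x + 64 * x ^ 2 - 64 * x ^ 3) * euler (euler (euler genFun)) x +
      (-24 * x + 192 * x ^ 2 - 288 * x ^ 3) * euler (euler genFun) x +
      (-16 * x + 208 * x ^ 2 - 432 * x ^ 3) * euler genFun x +
      (-4 * x + 80 * x ^ 2 - 216 * x ^ 3) * genFun x = 0 := by
  have hL : 0 < 6 + 2 * Real.sqrt 5 := by positivity
  have g0 := growthLE_coeff
  have g1 := g0.nat_mul hL
  have g2 := g1.nat_mul hL
  have g3 := g2.nat_mul hL
  have hev : ∀ᶠ y in 𝓝 x, ‖y‖ < 1 / (6 + 2 * Real.sqrt 5) :=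
    continuous_norm.continuousAt.eventually_lt continuousAt_const hx
  have e1 : ∀ y : ℂ, ‖y‖ < 1 / (6 + 2 * Real.sqrt 5) → euler genFun y =
      powerSum (fun n : ℕ => (n : ℂ) * (coeff n : ℂ)) y :=
    fun y hy => g0.euler_powerSum hL hy
  have e2 : ∀ y : ℂ, ‖y‖ < 1 / (6 + 2 * Real.sqrt 5) → euler (euler genFun) y =
      powerSum (fun n : ℕ => (n : ℂ) * ((n : ℂ) * (coeff n : ℂ))) y :=
    fun y hy => by
      rw [euler, EventuallyEq.deriv_eq
        ((continuous_norm.continuousAt.eventually_lt continuousAt_const hy).mono e1)]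
      exact g1.euler_powerSum hL hy
  have e3 : euler (euler (euler genFun)) x =
      powerSum (fun n : ℕ => (n : ℂ) * ((n : ℂ) * ((n : ℂ) * (coeff n : ℂ)))) x := by
    rw [euler, EventuallyEq.deriv_eq (hev.mono e2)]
    exact g2.euler_powerSum hL hx
  rw [e3, e2 x hx, e1 x hx, genFun]
  have s0 := g0.hasSum hL hx
  have s1 := g1.hasSum hL hx
  have s2 := g2.hasSum hL hx
  have s3 := g3.hasSum hL hx
  generalize powerSum (fun n => (coeff n : ℂ)) x = f0 at *
  generalize powerSum (fun n : ℕ => (n : ℂ) * (coeff n : ℂ)) x = f1 at *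
  generalize powerSum (fun n : ℕ => (n : ℂ) * ((n : ℂ) * (coeff n : ℂ))) x = f2 at *
  generalize powerSum (fun n : ℕ => (n : ℂ) * ((n : ℂ) * ((n : ℂ) * (coeff n : ℂ)))) x = f3 at *
  have t1 := (((s3.mul_left 16).add (s2.mul_left 24)).add (s1.mul_left 16)).add (s0.mul_left 4)
  have t2 := (((s3.mul_left 64).add (s2.mul_left 192)).add (s1.mul_left 208)).add (s0.mul_left 80)
  have t3 := (((s3.mul_left 64).add (s2.mul_left 288)).add (s1.mul_left 432)).add (s0.mul_left 216)
  have r0 := (hasSum_nat_add_iff' 3).mpr s3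
  have r1 := ((hasSum_nat_add_iff' 2).mpr t1).mul_left x
  have r2 := ((hasSum_nat_add_iff' 1).mpr t2).mul_left (x ^ 2)
  have r3 := t3.mul_left (x ^ 3)
  have r := ((r0.sub r1).add r2).sub r3
  have hz := HasSum.unique (r.congr_zero fun n => by
    have h : ((n : ℂ) + 3) ^ 3 * (coeff (n + 3) : ℂ) =
        4 * (2 * ((n : ℂ) + 2) + 1) * (2 * ((n : ℂ) + 2) ^ 2 + 2 * ((n : ℂ) + 2) + 1) *
        (coeff (n + 2) : ℂ) - 16 * ((n : ℂ) + 2) * (4 * ((n : ℂ) + 2) ^ 2 + 1) * (coeff (n + 1) : ℂ) +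
        8 * (2 * ((n : ℂ) + 2) - 1) ^ 3 * (coeff n : ℂ) := by
      exact_mod_cast congrArg ((↑) : ℚ → ℂ) (coeff_add_three n)
    push_cast
    linear_combination x ^ (n + 3) * h) hasSum_zero
  simp only [Finset.sum_range_succ, Finset.sum_range_zero, coeff] at hz
  push_cast at hz
  linear_combination hz

/-! ### The third order differential equation and its holomorphic solution -/

theorem euler_congr {F G : ℂ → ℂ} {q : ℂ} (h : F =ᶠ[𝓝 q] G) : euler F q = euler G q := by
  rw [euler, euler, h.deriv_eq]

theorem hasDerivAt_of_euler {F : ℂ → ℂ} {q v : ℂ} (hF : AnalyticAt ℂ F q) (hq : q ≠ 0)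
    (h : euler F q = v) : HasDerivAt F (v / q) q := by
  rw [← h, euler, mul_div_cancel_left₀ _ hq]
  exact hF.differentiableAt.hasDerivAt

/-- If `g θ = q d/dq` with `g = Z √w(X)` and `θ X = X`, then the second order nonlinear equation for
`Z` implies, after one more differentiation, a third order linear one. -/
theorem third_order_of_second_order {Z X g P Q S : ℂ → ℂ}
    (hZ : AnalyticAt ℂ Z 0) (hX : AnalyticAt ℂ X 0) (hg : AnalyticAt ℂ g 0)
    (hP : AnalyticAt ℂ P 0) (hQ : AnalyticAt ℂ Q 0)
    (eX : ∀ᶠ q in 𝓝 0, euler X q = g q * X q) (eZ : ∀ᶠ q in 𝓝 0, euler Z q = g q * P q)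
    (eP : ∀ᶠ q in 𝓝 0, euler P q = g q * Q q) (eQ : ∀ᶠ q in 𝓝 0, euler Q q = g q * S q)
    (g0 : g 0 ≠ 0) (Z0 : Z 0 ≠ 0)
    (h1 : ∀ᶠ q in 𝓝 0, g q ^ 2 = Z q ^ 2 * (1 - 16 * X q + 64 * X q ^ 2 - 64 * X q ^ 3))
    (h2 : ∀ᶠ q in 𝓝 0, 2 * Z q * euler (euler Z) q - 3 * euler Z q ^ 2 =
      Z q ^ 4 * (8 * X q - 80 * X q ^ 2 + 144 * X q ^ 3)) :
    ∀ᶠ q in 𝓝[≠] 0, (1 - 16 * X q + 64 * X q ^ 2 - 64 * X q ^ 3) * S q +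
      (-24 * X q + 192 * X q ^ 2 - 288 * X q ^ 3) * Q q +
      (-16 * X q + 208 * X q ^ 2 - 432 * X q ^ 3) * P q +
      (-4 * X q + 80 * X q ^ 2 - 216 * X q ^ 3) * Z q = 0 := by
  -- the second order equation, rewritten by means of `θ`
  have hmid : ∀ᶠ q in 𝓝 (0 : ℂ), q ≠ 0 →
      -(1 - 16 * X q + 64 * X q ^ 2 - 64 * X q ^ 3) * P q ^ 2 +
        Z q * (-16 * X q + 128 * X q ^ 2 - 192 * X q ^ 3) * P q +
        2 * Z q * (1 - 16 * X q + 64 * X q ^ 2 - 64 * X q ^ 3) * Q q =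
      Z q ^ 2 * (8 * X q - 80 * X q ^ 2 + 144 * X q ^ 3) := by
    filter_upwards [hZ.eventually_analyticAt, hX.eventually_analyticAt, hg.eventually_analyticAt,
      hP.eventually_analyticAt, eX, eZ.eventually_nhds, eP,
      hg.continuousAt.eventually_ne g0, hZ.continuousAt.eventually_ne Z0, h1.eventually_nhds, h2]
      with q aZ aX ag aP eX eZ eP g0 Z0 h1 h2 hq
    have dX := hasDerivAt_of_euler aX hq eX
    have dZ := hasDerivAt_of_euler aZ hq eZ.self_of_nhds
    have dP := hasDerivAt_of_euler aP hq eP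
    have dg : HasDerivAt g (euler g q / q) q := hasDerivAt_of_euler ag hq rfl
    -- differentiate the relation `g² = Z² w(X)`
    have d1 := dg.pow 2
    have d2 := (dZ.pow 2).mul ((((dX.const_mul 16).const_sub 1).add
      ((dX.pow 2).const_mul 64)).sub ((dX.pow 3).const_mul 64))
    have d3 := d1.unique (d2.congr_of_eventuallyEq (by
      filter_upwards [h1] with s hs
      simpa using hs))
    simp only [Pi.pow_apply, Pi.add_apply, Pi.sub_apply] at d3
    have e1 : euler g q = Z q * P q * (1 - 16 * X q + 64 * X q ^ 2 - 64 * X q ^ 3) +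
        Z q ^ 2 * (-16 * X q + 128 * X q ^ 2 - 192 * X q ^ 3) / 2 := by
      have h2g : 2 * g q ≠ 0 := mul_ne_zero two_ne_zero g0
      apply mul_left_cancel₀ h2g
      field_simp at d3
      push_cast at d3
      linear_combination d3
    have e2 : euler (euler Z) q = euler g q * P q + g q ^ 2 * Q q := by
      have d4 := dg.mul dP
      rw [euler_congr eZ, euler, HasDerivAt.deriv (f := fun q => g q * P q) d4]
      field_simp
    rw [e2, e1, eZ.self_of_nhds, h1.self_of_nhds] at h2
    apply mul_left_cancel₀ (pow_ne_zero 2 Z0)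
    linear_combination h2 + 3 * P q ^ 2 * h1.self_of_nhds
  have hmid' : ∀ᶠ q in 𝓝[≠] (0 : ℂ), ∀ᶠ s in 𝓝 q,
      -(1 - 16 * X s + 64 * X s ^ 2 - 64 * X s ^ 3) * P s ^ 2 +
        Z s * (-16 * X s + 128 * X s ^ 2 - 192 * X s ^ 3) * P s +
        2 * Z s * (1 - 16 * X s + 64 * X s ^ 2 - 64 * X s ^ 3) * Q s =
      Z s ^ 2 * (8 * X s - 80 * X s ^ 2 + 144 * X s ^ 3) := by
    filter_upwards [nhdsWithin_le_nhds hmid.eventually_nhds, self_mem_nhdsWithin] with q h hq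
    filter_upwards [h, isOpen_ne.mem_nhds hq] with s hs hs0 using hs hs0
  filter_upwards [nhdsWithin_le_nhds hZ.eventually_analyticAt,
    nhdsWithin_le_nhds hX.eventually_analyticAt,
    nhdsWithin_le_nhds hP.eventually_analyticAt, nhdsWithin_le_nhds hQ.eventually_analyticAt,
    nhdsWithin_le_nhds eX, nhdsWithin_le_nhds eZ, nhdsWithin_le_nhds eP, nhdsWithin_le_nhds eQ,
    nhdsWithin_le_nhds (hg.continuousAt.eventually_ne g0),
    nhdsWithin_le_nhds (hZ.continuousAt.eventually_ne Z0), hmid', self_mem_nhdsWithin]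
    with q aZ aX aP aQ eX eZ eP eQ g0 Z0 h hq
  have hq : q ≠ 0 := hq
  have dX := hasDerivAt_of_euler aX hq eX
  have dZ := hasDerivAt_of_euler aZ hq eZ
  have dP := hasDerivAt_of_euler aP hq eP
  have dQ := hasDerivAt_of_euler aQ hq eQ
  -- differentiate the second order equation
  have dw := (((dX.const_mul 16).const_sub 1).add
      ((dX.pow 2).const_mul 64)).sub ((dX.pow 3).const_mul 64)
  have dw1 := ((dX.const_mul (-16)).add ((dX.pow 2).const_mul 128)).sub ((dX.pow 3).const_mul 192)
  have dR := ((dX.const_mul 8).sub ((dX.pow 2).const_mul 80)).add ((dX.pow 3).const_mul 144)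
  have dl := ((dw.neg.mul (dP.pow 2)).add ((dZ.mul dw1).mul dP)).add
    (((dZ.const_mul 2).mul dw).mul dQ)
  have dr := (dZ.pow 2).mul dR
  have key := dl.unique (dr.congr_of_eventuallyEq (by
    filter_upwards [h] with s hs
    simpa using hs))
  simp only [Pi.pow_apply, Pi.add_apply, Pi.sub_apply, Pi.neg_apply, Pi.mul_apply] at key
  field_simp at key
  push_cast at key
  have h2g : 2 * Z q ≠ 0 := mul_ne_zero two_ne_zero Z0
  apply mul_left_cancel₀ h2g
  linear_combination key

/-- The operator `θ = g⁻¹ q d/dq` with `g 0 = 1` preserves the order of vanishing `k` and multiplies the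
leading coefficient by `k`. -/
theorem euler_eq_mul_of_eq_pow_mul {k : ℕ} {F F' g e : ℂ → ℂ} (he : AnalyticAt ℂ e 0)
    (hg : AnalyticAt ℂ g 0) (g0 : g 0 = 1) (hF : ∀ᶠ q in 𝓝 0, F q = q ^ k * e q)
    (hF' : ∀ᶠ q in 𝓝 0, euler F q = g q * F' q) :
    ∃ e', AnalyticAt ℂ e' 0 ∧ e' 0 = k * e 0 ∧ ∀ᶠ q in 𝓝 0, F' q = q ^ k * e' q := by
  have g0' : g 0 ≠ 0 := by rw [g0]; exact one_ne_zero
  have he' := he.euler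
  refine ⟨fun q => (k * e q + euler e q) / g q, AnalyticAt.fun_div (by fun_prop) hg g0',
    by simp [g0, euler], ?_⟩
  filter_upwards [hF.eventually_nhds, hF', hg.continuousAt.eventually_ne g0',
    he.eventually_analyticAt] with q h1 h2 h3 h4
  have d := ((hasDerivAt_id q).pow k).mul h4.differentiableAt.hasDerivAt
  rw [euler, (d.congr_of_eventuallyEq h1).deriv] at h2
  apply mul_left_cancel₀ h3
  rw [← h2, euler]
  field_simp
  rcases k with _ | k
  · simp
  · simp only [id, Pi.pow_apply, Nat.add_sub_cancel]
    push_cast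
    ring

/-- All exponents at the origin of the differential equation are zero, so a holomorphic solution
that vanishes at the origin vanishes identically. -/
theorem eventually_eq_zero_of_third_order {g E E₁ E₂ E₃ W α β γ : ℂ → ℂ}
    (hE : AnalyticAt ℂ E 0) (hE0 : E 0 = 0) (hg : AnalyticAt ℂ g 0) (g0 : g 0 = 1)
    (h1 : ∀ᶠ q in 𝓝 0, euler E q = g q * E₁ q) (h2 : ∀ᶠ q in 𝓝 0, euler E₁ q = g q * E₂ q)
    (h3 : ∀ᶠ q in 𝓝 0, euler E₂ q = g q * E₃ q)
    (hW : ContinuousAt W 0) (hα : ContinuousAt α 0) (hβ : ContinuousAt β 0)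
    (hγ : ContinuousAt γ 0) (W0 : W 0 = 1) (α0 : α 0 = 0) (β0 : β 0 = 0) (γ0 : γ 0 = 0)
    (h : ∀ᶠ q in 𝓝[≠] 0, W q * E₃ q + α q * E₂ q + β q * E₁ q + γ q * E q = 0) :
    ∀ᶠ q in 𝓝 0, E q = 0 := by
  by_contra hne
  obtain ⟨k, e, he, e0, hk⟩ := hE.exists_eventuallyEq_pow_smul_nonzero_iff.mpr hne
  simp only [sub_zero, smul_eq_mul] at hk
  have hk0 : (k : ℂ) ≠ 0 := by
    rintro hk0
    have hk0 : k = 0 := by exact_mod_cast hk0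
    have := hk.self_of_nhds
    rw [hE0, hk0, pow_zero, one_mul] at this
    exact e0 this.symm
  obtain ⟨e₁, a₁, b₁, k₁⟩ := euler_eq_mul_of_eq_pow_mul he hg g0 hk h1
  obtain ⟨e₂, a₂, b₂, k₂⟩ := euler_eq_mul_of_eq_pow_mul a₁ hg g0 k₁ h2
  obtain ⟨e₃, a₃, b₃, k₃⟩ := euler_eq_mul_of_eq_pow_mul a₂ hg g0 k₂ h3
  have hz : ∀ᶠ q in 𝓝[≠] 0, W q * e₃ q + α q * e₂ q + β q * e₁ q + γ q * e q = 0 := by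
    filter_upwards [h, nhdsWithin_le_nhds hk, nhdsWithin_le_nhds k₁, nhdsWithin_le_nhds k₂,
      nhdsWithin_le_nhds k₃, self_mem_nhdsWithin] with q h i0 i1 i2 i3 hq
    have hq : q ≠ 0 := hq
    apply mul_left_cancel₀ (pow_ne_zero k hq)
    rw [i0, i1, i2, i3] at h
    linear_combination h
  have hc : ContinuousAt (fun q => W q * e₃ q + α q * e₂ q + β q * e₁ q + γ q * e q) 0 :=
    (((hW.mul a₃.continuousAt).add (hα.mul a₂.continuousAt)).add
      (hβ.mul a₁.continuousAt)).add (hγ.mul he.continuousAt)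
  have := tendsto_nhds_unique_of_eventuallyEq (hc.tendsto.mono_left nhdsWithin_le_nhds)
    tendsto_const_nhds hz
  rw [W0, α0, β0, γ0, b₃, b₂, b₁] at this
  simp [hk0, e0] at this

/-- The expansion in `q` of the function `z / Z`. -/
noncomputable def XSeries (q : ℂ) : ℂ := q * (uSeries q / ZSeries q)

theorem analyticAt_uSeries_div_ZSeries : AnalyticAt ℂ (fun q => uSeries q / ZSeries q) 0 :=
  analyticAt_uSeries.fun_div analyticAt_ZSeries (by rw [ZSeries_zero]; exact one_ne_zero)

theorem eventually_uSeries_div_ZSeries_ne_zero : ∀ᶠ q in 𝓝 0, uSeries q / ZSeries q ≠ 0 :=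
  analyticAt_uSeries_div_ZSeries.continuousAt.eventually_ne
    (show uSeries 0 / ZSeries 0 ≠ 0 by rw [ZSeries_zero, uSeries_zero]; norm_num)

theorem analyticAt_XSeries : AnalyticAt ℂ XSeries 0 :=
  analyticAt_id.mul analyticAt_uSeries_div_ZSeries

theorem XSeries_zero : XSeries 0 = 0 := by simp [XSeries]

/-- The logarithmic derivative `q X' / X` of `XSeries`, in a form that is regular at the origin. -/
noncomputable def XLogDeriv (q : ℂ) : ℂ :=
  (uSeries q / ZSeries q + euler (fun q => uSeries q / ZSeries q) q) / (uSeries q / ZSeries q)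

theorem analyticAt_XLogDeriv : AnalyticAt ℂ XLogDeriv 0 := by
  have h := analyticAt_uSeries_div_ZSeries
  exact (h.fun_add h.euler).fun_div h (by rw [ZSeries_zero, uSeries_zero]; norm_num)

theorem XLogDeriv_zero : XLogDeriv 0 = 1 := by
  simp [XLogDeriv, ZSeries_zero, uSeries_zero, euler]

theorem eventually_euler_XSeries :
    ∀ᶠ q in 𝓝 0, euler XSeries q = XLogDeriv q * XSeries q := by
  have h := analyticAt_uSeries_div_ZSeries
  filter_upwards [h.eventually_analyticAt,
    eventually_uSeries_div_ZSeries_ne_zero] with q h1 h2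
  rw [show euler XSeries q = _ from euler_id_mul h1, XLogDeriv, XSeries, div_mul_eq_mul_div,
    eq_div_iff h2]
  ring

/-- The first differential equation, divided by `X² Z⁴`. -/
theorem eventually_XLogDeriv_sq : ∀ᶠ q in 𝓝 0, XLogDeriv q ^ 2 =
    ZSeries q ^ 2 * (1 - 16 * XSeries q + 64 * XSeries q ^ 2 - 64 * XSeries q ^ 3) := by
  have h := analyticAt_uSeries_div_ZSeries
  have hZ0 : ZSeries 0 ≠ 0 := by rw [ZSeries_zero]; exact one_ne_zero
  have hz : ∀ᶠ q in 𝓝 0, zSeries q = XSeries q * ZSeries q := by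
    filter_upwards [analyticAt_ZSeries.continuousAt.eventually_ne hZ0] with q hq
    rw [zSeries, XSeries]
    field_simp
  filter_upwards [hz.eventually_nhds, series_differential_equations, eventually_euler_XSeries,
    analyticAt_ZSeries.eventually_analyticAt, analyticAt_XSeries.eventually_analyticAt,
    analyticAt_ZSeries.continuousAt.eventually_ne hZ0,
    eventually_uSeries_div_ZSeries_ne_zero]
    with q hz h1 eX aZ aX Z0 x0
  rcases eq_or_ne q 0 with rfl | hq
  · rw [XLogDeriv_zero, ZSeries_zero, XSeries_zero]; norm_num
  have X0 : XSeries q ≠ 0 := mul_ne_zero hq x0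
  have ez : euler zSeries q = XLogDeriv q * XSeries q * ZSeries q + XSeries q * euler ZSeries q := by
    have d := (hasDerivAt_of_euler aX hq eX).mul (hasDerivAt_of_euler aZ hq rfl)
    rw [euler_congr hz, euler, HasDerivAt.deriv (f := fun q => XSeries q * ZSeries q) d]
    field_simp
  have h2 := h1.1
  rw [ez, hz.self_of_nhds] at h2
  apply mul_left_cancel₀ (mul_ne_zero (pow_ne_zero 2 X0) (pow_ne_zero 4 Z0))
  linear_combination h2

/-- Near the cusp, `Z` is the generating function evaluated at `X`. -/
theorem eventually_ZSeries_eq_genFun : ∀ᶠ q in 𝓝 0, ZSeries q = genFun (XSeries q) := by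
  have hZ := analyticAt_ZSeries
  have hX := analyticAt_XSeries
  have hg := analyticAt_XLogDeriv
  have g0 := XLogDeriv_zero
  have g0' : XLogDeriv 0 ≠ 0 := by rw [g0]; exact one_ne_zero
  have hZ0 : ZSeries 0 ≠ 0 := by rw [ZSeries_zero]; exact one_ne_zero
  -- the iterated derivatives of a function by `θ = g⁻¹ q d/dq`
  have hθ : ∀ F : ℂ → ℂ, AnalyticAt ℂ F 0 → ∃ P : ℂ → ℂ, AnalyticAt ℂ P 0 ∧
      ∀ᶠ q in 𝓝 0, euler F q = XLogDeriv q * P q := fun F hF => by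
    refine ⟨fun q => euler F q / XLogDeriv q, hF.euler.fun_div hg g0', ?_⟩
    filter_upwards [hg.continuousAt.eventually_ne g0'] with q hq
    field_simp
  obtain ⟨P, hP, eZ⟩ := hθ _ hZ
  obtain ⟨Q, hQ, eP⟩ := hθ _ hP
  obtain ⟨S, hS, eQ⟩ := hθ _ hQ
  have ode := third_order_of_second_order hZ hX hg hP hQ eventually_euler_XSeries eZ eP eQ g0' hZ0
    eventually_XLogDeriv_sq (by
      filter_upwards [series_differential_equations, hZ.continuousAt.eventually_ne hZ0] with q h hq
      have hz : zSeries q = XSeries q * ZSeries q := by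
        rw [zSeries, XSeries]; field_simp
      rw [h.2, hz]; ring)
  have hL : 0 < 6 + 2 * Real.sqrt 5 := by positivity
  have hf : AnalyticAt ℂ genFun 0 := growthLE_coeff.analyticAt hL (by simpa using hL)
  -- the chain rule: `θ` acts on functions of `X` as the Euler operator
  have hcomp : ∀ F : ℂ → ℂ, AnalyticAt ℂ F 0 → AnalyticAt ℂ (fun q => F (XSeries q)) 0 ∧
      ∀ᶠ q in 𝓝 0, euler (fun q => F (XSeries q)) q = XLogDeriv q * euler F (XSeries q) :=
    fun F hF => by
      refine ⟨AnalyticAt.fun_comp (by rwa [XSeries_zero]) hX, ?_⟩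
      have hXt : Tendsto XSeries (𝓝 0) (𝓝 0) := by
        simpa [XSeries_zero] using hX.continuousAt.tendsto
      filter_upwards [hXt.eventually hF.eventually_analyticAt, hX.eventually_analyticAt,
        eventually_euler_XSeries] with q h1 h2 h3
      have d := h1.differentiableAt.hasDerivAt.comp q h2.differentiableAt.hasDerivAt
      rw [euler, HasDerivAt.deriv (f := fun q => F (XSeries q)) d]
      rw [euler] at h3
      rw [euler]
      linear_combination deriv F (XSeries q) * h3
  obtain ⟨c₀, d₀⟩ := hcomp _ hf
  obtain ⟨c₁, d₁⟩ := hcomp _ hf.euler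
  obtain ⟨c₂, d₂⟩ := hcomp _ hf.euler.euler
  have hsub : ∀ F G F' G' : ℂ → ℂ, AnalyticAt ℂ F 0 → AnalyticAt ℂ G 0 →
      (∀ᶠ q in 𝓝 0, euler F q = XLogDeriv q * F' q) →
      (∀ᶠ q in 𝓝 0, euler G q = XLogDeriv q * G' q) →
      ∀ᶠ q in 𝓝 0, euler (fun q => F q - G q) q = XLogDeriv q * (F' q - G' q) :=
    fun F G F' G' hF hG h1 h2 => by
      filter_upwards [hF.eventually_analyticAt, hG.eventually_analyticAt, h1, h2] with q a b h1 h2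
      have d := a.differentiableAt.hasDerivAt.sub b.differentiableAt.hasDerivAt
      rw [euler, HasDerivAt.deriv (f := fun q => F q - G q) d, mul_sub, mul_sub, ← h1, ← h2,
        euler, euler]
  have gf0 : genFun 0 = 1 := by
    have := (growthLE_coeff.hasSum hL (x := 0) (by simpa using hL)).unique
      (hasSum_single 0 fun n hn => by simp [hn])
    rw [genFun]
    simpa [coeff] using this
  have hXc := hX.continuousAt
  have key := eventually_eq_zero_of_third_order
    (W := fun q => 1 - 16 * XSeries q + 64 * XSeries q ^ 2 - 64 * XSeries q ^ 3)
    (α := fun q => -24 * XSeries q + 192 * XSeries q ^ 2 - 288 * XSeries q ^ 3)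
    (β := fun q => -16 * XSeries q + 208 * XSeries q ^ 2 - 432 * XSeries q ^ 3)
    (γ := fun q => -4 * XSeries q + 80 * XSeries q ^ 2 - 216 * XSeries q ^ 3)
    (hZ.fun_sub c₀) (by simp [ZSeries_zero, XSeries_zero, gf0]) hg g0
    (hsub _ _ _ _ hZ c₀ eZ d₀) (hsub _ _ _ _ hP c₁ eP d₁) (hsub _ _ _ _ hQ c₂ eQ d₂)
    (by fun_prop) (by fun_prop) (by fun_prop) (by fun_prop)
    (by simp [XSeries_zero]) (by simp [XSeries_zero]) (by simp [XSeries_zero])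
    (by simp [XSeries_zero]) (by
      have hXt : Tendsto (fun q => ‖XSeries q‖) (𝓝 0) (𝓝 0) := by
        simpa [XSeries_zero] using hXc.norm.tendsto
      filter_upwards [ode, nhdsWithin_le_nhds (hXt.eventually_lt_const
        (show 0 < 1 / (6 + 2 * Real.sqrt 5) by positivity))] with q h1 h2
      linear_combination h1 - genFun_differential_equation h2)
  filter_upwards [key] with q hq
  exact sub_eq_zero.mp hq

/-! ### Continuation to the component of the cusp -/

theorem Z_eq (τ : ℂ) : Z τ = prodFive thetaSq₃ (2 * τ) := by
  have h : ∀ (n : ℤ) (c : ℤ), nome τ ^ (c * n ^ 2) =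
      cexp (Real.pi * I * (n : ℂ) ^ 2 * (c * (2 * τ))) := fun n c => by
    rw [nome, ← Complex.exp_int_mul]
    congr 1
    push_cast
    ring
  have h1 : ∀ n m : ℤ, nome τ ^ (m ^ 2 + 5 * n ^ 2) =
      cexp (Real.pi * I * (m : ℂ) ^ 2 * (2 * τ)) *
        cexp (Real.pi * I * (n : ℂ) ^ 2 * (5 * (2 * τ))) := fun n m => by
    have h0 : nome τ ≠ 0 := Complex.exp_ne_zero _
    rw [zpow_add₀ h0]
    have a := h m 1
    have b := h n 5
    push_cast at a b
    rw [one_mul, one_mul] at a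
    rw [a, b]
  simp only [Z, h1, tsum_mul_left, tsum_mul_right]
  rw [prodFive, thetaSq₃, thetaSq₃, ← mul_pow]
  rfl

theorem z_eq (τ : ℂ) : z τ = etaProd (2 * τ) := by
  rw [z, etaProd, prodFive, show 5 * (2 * τ) = 10 * τ by ring]

theorem tendsto_two_mul_atCusp : Tendsto (fun τ : ℂ => 2 * τ) atCusp atCusp := by
  refine tendsto_comap_iff.mpr ?_
  have : (Complex.im ∘ fun τ : ℂ => 2 * τ) = fun τ : ℂ => 2 * τ.im := funext fun τ => by simp
  rw [this]
  exact tendsto_comap.const_mul_atTop two_pos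

theorem tendsto_cuspParam_two_mul : Tendsto (fun τ => cuspParam (2 * τ)) atCusp (𝓝 0) :=
  tendsto_cuspParam.comp tendsto_two_mul_atCusp

theorem eventually_Z_eq : ∀ᶠ τ in atCusp, Z τ = ZSeries (cuspParam (2 * τ)) := by
  filter_upwards [tendsto_two_mul_atCusp.eventually eventually_prodFive_thetaSq₃_eq] with τ h
  rw [Z_eq, h]

theorem eventually_X_eq : ∀ᶠ τ in atCusp, X τ = XSeries (cuspParam (2 * τ)) := by
  filter_upwards [eventually_Z_eq] with τ h
  rw [X, h, z_eq, etaProd_eq, zSeries, XSeries, mul_div_assoc]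

theorem eventually_Z_eq_genFun_X : ∀ᶠ τ in atCusp, Z τ = genFun (X τ) := by
  filter_upwards [eventually_Z_eq, eventually_X_eq,
    tendsto_cuspParam_two_mul.eventually eventually_ZSeries_eq_genFun] with τ h1 h2 h3
  rw [h1, h2, h3]

theorem three_sub_sqrt_five_div_eight_pos : 0 < (3 - Real.sqrt 5) / 8 := by
  rw [three_sub_sqrt_five_div_eight]; positivity

theorem eventually_mem_smallX : ∀ᶠ τ in atCusp, τ ∈ smallX := by
  have h : Tendsto (fun τ => ‖XSeries (cuspParam (2 * τ))‖) atCusp (𝓝 0) := by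
    simpa [XSeries_zero] using
      (analyticAt_XSeries.continuousAt.tendsto.comp tendsto_cuspParam_two_mul).norm
  filter_upwards [eventually_im_pos, eventually_X_eq,
    h.eventually_lt_const three_sub_sqrt_five_div_eight_pos] with τ h1 h2 h3
  exact ⟨h1, by rwa [h2]⟩

theorem exists_forall_of_eventually_atCusp {p : ℂ → Prop} (h : ∀ᶠ τ in atCusp, p τ) :
    ∃ C : ℝ, ∀ τ : ℂ, C < τ.im → p τ := by
  obtain ⟨U, hU, hp⟩ := (eventually_comap.mp h).exists_mem
  obtain ⟨C, hC⟩ := mem_atTop_sets.mp hU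
  exact ⟨C, fun τ hτ => hp _ (hC _ hτ.le) τ rfl⟩

theorem exists_halfPlane_subset_cuspComponent :
    ∃ C : ℝ, ∀ τ : ℂ, C < τ.im → τ ∈ cuspComponent := by
  obtain ⟨C, hC⟩ := exists_forall_of_eventually_atCusp eventually_mem_smallX
  exact ⟨C, fun τ hτ => ⟨{τ | C < τ.im}, ⟨fun σ hσ => hC σ hσ,
    (convex_halfSpace_im_gt C).isPreconnected, C, subset_rfl⟩, hτ⟩⟩

theorem analyticOnNhd_Z : AnalyticOnNhd ℂ Z {τ | 0 < τ.im} := by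
  have h : Z = fun τ => prodFive thetaSq₃ (2 * τ) := funext Z_eq
  rw [h]
  exact ((differentiableOn_prodFive differentiableOn_thetaSq₃).comp (by fun_prop)
    fun τ hτ => by simpa using hτ).analyticOnNhd isOpen_im_pos

theorem analyticOnNhd_z : AnalyticOnNhd ℂ z {τ | 0 < τ.im} := by
  have h : z = fun τ => etaProd (2 * τ) := funext z_eq
  rw [h]
  exact ((differentiableOn_prodFive differentiableOn_eta_sq).comp (by fun_prop)
    fun τ hτ => by simpa using hτ).analyticOnNhd isOpen_im_pos

/-- The function `X` has a pole at a zero of `Z`, so such a zero would be an isolated point of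
`smallX`. -/
theorem Z_ne_zero_of_mem {S : Set ℂ} (hS : S ⊆ smallX) (hc : IsPreconnected S) {C : ℝ}
    (hC : {τ : ℂ | C < τ.im} ⊆ S) {p : ℂ} (hp : p ∈ S) : Z p ≠ 0 := by
  intro hZp
  have hp0 : 0 < p.im := (hS hp).1
  have aZ := analyticOnNhd_Z p hp0
  have az := analyticOnNhd_z p hp0
  have hzp : z p ≠ 0 := by rw [z_eq]; exact etaProd_ne_zero (by simpa using hp0)
  obtain ⟨r, hr⟩ : ∃ r, r = (3 - Real.sqrt 5) / 8 := ⟨_, rfl⟩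
  have hne : ∀ᶠ τ in 𝓝[≠] p, Z τ ≠ 0 := by
    refine aZ.eventually_eq_zero_or_eventually_ne_zero.resolve_left fun h => ?_
    have hall := analyticOnNhd_Z.eqOn_zero_of_preconnected_of_eventuallyEq_zero
      (convex_halfSpace_im_gt 0).isPreconnected hp0 h
    have h1 : Tendsto (fun τ => ZSeries (cuspParam (2 * τ))) atCusp (𝓝 1) := by
      simpa [ZSeries_zero, Function.comp_def] using
        analyticAt_ZSeries.continuousAt.tendsto.comp tendsto_cuspParam_two_mul
    obtain ⟨C', hC'⟩ := exists_forall_of_eventually_atCusp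
      ((eventually_Z_eq.and eventually_im_pos).and (h1.eventually_ne one_ne_zero))
    have h2 := hC' ((C' + 1 : ℝ) * I) (by simp)
    exact h2.2 (by rw [← h2.1.1]; exact hall h2.1.2)
  have hbig : ∀ᶠ τ in 𝓝 p, r * ‖Z τ‖ < ‖z τ‖ := by
    refine ContinuousAt.eventually_lt (aZ.continuousAt.norm.const_mul r)
      az.continuousAt.norm ?_
    simpa [hZp] using hzp
  have hiso : ∀ᶠ τ in 𝓝 p, τ ≠ p → τ ∉ S := by
    filter_upwards [hbig, eventually_nhdsWithin_iff.mp hne] with τ h1 h2 hτ hτS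
    have h3 := (hS hτS).2
    rw [X, norm_div, div_lt_iff₀ (norm_pos_iff.mpr (h2 hτ)), ← hr] at h3
    linarith
  obtain ⟨U, hU, hUo, hpU⟩ := eventually_nhds_iff.mp hiso
  obtain ⟨y, hyC, hyp⟩ : ∃ y : ℂ, C < y.im ∧ y ≠ p :=
    ⟨((max C p.im + 1 : ℝ) : ℂ) * I, by
      simp only [mul_im, ofReal_re, Complex.I_im, mul_one, ofReal_im, Complex.I_re, mul_zero, add_zero]
      linarith [le_max_left C p.im], fun h => by
      have := congrArg Complex.im h
      simp only [mul_im, ofReal_re, Complex.I_im, mul_one, ofReal_im, Complex.I_re, mul_zero, add_zero] at this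
      linarith [le_max_right C p.im]⟩
  obtain ⟨w, hwS, hwU, hwp⟩ := hc U {p}ᶜ hUo isOpen_compl_singleton
    (fun s _ => (em (s = p)).elim (fun h => Or.inl (h ▸ hpU)) fun h => Or.inr h)
    ⟨p, hp, hpU⟩ ⟨y, hC hyC, hyp⟩
  exact hU w hwU hwp hwS

/-- The identity near the cusp propagates along a connected set on which `X` is holomorphic and stays
in the disc of convergence. -/
theorem Z_eq_genFun_X_of_mem {τ : ℂ} (hτ : τ ∈ cuspComponent) : Z τ = genFun (X τ) := by
  obtain ⟨S, ⟨hS, hc, C, hC⟩, hτS⟩ := hτ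
  obtain ⟨C', hC'⟩ := exists_forall_of_eventually_atCusp eventually_Z_eq_genFun_X
  have hL : 0 < 6 + 2 * Real.sqrt 5 := by positivity
  have hX : AnalyticOnNhd ℂ X S := fun p hp =>
    (analyticOnNhd_z p (hS hp).1).fun_div (analyticOnNhd_Z p (hS hp).1)
      (Z_ne_zero_of_mem hS hc hC hp)
  have hf : AnalyticOnNhd ℂ (fun σ => genFun (X σ)) S := fun p hp =>
    AnalyticAt.fun_comp (growthLE_coeff.analyticAt hL (by
      rw [← three_sub_sqrt_five_div_eight]; exact (hS hp).2)) (hX p hp)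
  have hy : max C C' < (((max C C' + 1 : ℝ) : ℂ) * I).im := by simp
  refine AnalyticOnNhd.eqOn_of_preconnected_of_eventuallyEq
    (fun p hp => analyticOnNhd_Z p (hS hp).1) hf hc
    (hC (lt_of_le_of_lt (le_max_left C C') hy)) ?_ hτS
  filter_upwards [(isOpen_lt continuous_const Complex.continuous_im).mem_nhds
    (lt_of_le_of_lt (le_max_right C C') hy)] with σ hσ
  exact hC' σ hσ

end Level20

theorem mainTheorem3 :
    ∃ a : ℕ → ℚ,
      a 0 = 1 ∧ a 1 = 4 ∧ a 2 = 20 ∧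
      (∀ n : ℕ, 2 ≤ n →
        ((n : ℚ) + 1) ^ 3 * a (n + 1) =
          4 * (2 * (n : ℚ) + 1) * (2 * (n : ℚ) ^ 2 + 2 * (n : ℚ) + 1) * a n
            - 16 * (n : ℚ) * (4 * (n : ℚ) ^ 2 + 1) * a (n - 1)
            + 8 * (2 * (n : ℚ) - 1) ^ 3 * a (n - 2)) ∧
      (∀ x : ℂ, ‖x‖ < (3 - Real.sqrt 5) / 8 → Summable (fun n : ℕ => (a n : ℂ) * x ^ n)) ∧
      (∃ C : ℝ, ∀ τ : ℂ, C < τ.im → τ ∈ Level20.cuspComponent) ∧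
      (∀ τ : ℂ, τ ∈ Level20.cuspComponent →
        HasSum (fun n : ℕ => (a n : ℂ) * Level20.X τ ^ n) (Level20.Z τ)) := by
  have hL : 0 < 6 + 2 * Real.sqrt 5 := by positivity
  refine ⟨Level20.coeff, rfl, rfl, rfl, ?_, ?_, Level20.exists_halfPlane_subset_cuspComponent, ?_⟩
  · intro n hn
    obtain ⟨m, rfl⟩ := Nat.exists_eq_add_of_le' hn
    have h := Level20.coeff_add_three m
    simp only [Nat.add_sub_cancel, show m + 2 - 1 = m + 1 by omega, show m + 2 + 1 = m + 3 by omega]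
    push_cast
    linear_combination h
  · intro x hx
    rw [Level20.three_sub_sqrt_five_div_eight] at hx
    exact (Level20.growthLE_coeff.hasSum hL hx).summable
  · intro τ hτ
    rw [Level20.Z_eq_genFun_X_of_mem hτ]
    obtain ⟨S, ⟨hS, -⟩, hτS⟩ := hτ
    have hx := (hS hτS).2
    rw [Level20.three_sub_sqrt_five_div_eight] at hx
    exact Level20.growthLE_coeff.hasSum hL hx
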